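/- Setup. Let $(\Omega,\mathcal F,(\mathcal F_n)_{n\ge 0})$ be a filtered measurable space and let $(E_n^{(1)})_{n\ge1},(E_n^{(2)})_{n\ge1}$ be adapted real-valued processes. Say that the pairs are i.i.d. under a distribution $P$ if, under $P$, the pairs $(E_n^{(1)},E_n^{(2)})$ are almost surely nonnegative and identically distributed, and each $(E_n^{(1)},E_n^{(2)})$ is independent of $\mathcal F_{n-1}$. The null $\mathcal P$ is the set of probability distributions under which the pairs are i.i.d. and $E_1^{(1)},E_1^{(2)}$ have mean at most $1$. A betting strategy is a $[0,1]$-valued predictable process $(\lambda_n)_{n\ge1}$; its wealth is $W_n(\lambda_1,\dots,\lambda_n)=\prod_{i=1}^n((1-\lambda_i)E_i^{(1)}+\lambda_iE_i^{(2)})$, a test $\mathcal P$-supermartingale, and for a constant strategy $\lambda$ it is written $W_n(\lambda)$. With $\log 0=-\infty$, put $\ell_Q(\lambda)=\mathbb E_Q[\log((1-\lambda)E_1^{(1)}+\lambda E_1^{(2)})]\in[-\infty,\infty]$ and $\ell_Q^\star=\sup_{\lambda\in[0,1]}\ell_Q(\lambda)$. Let the alternative $\mathcal Q$ be any set of probability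 distributions under each of which the pairs are i.i.d. and $\ell_Q^\star$ is finite. Let $\mathcal W$ be the class of nonnegative adapted processes $W=(W_n)_{n\ge1}$ that are bounded above by the wealth of some betting strategy (almost surely under every $P\in\mathcal P\cup\mathcal Q$). Theorem. Let $W\in\mathcal W$ have portfolio regret $$\mathcal R_n=\max_{\lambda\in[0,1]}\sum_{i=1}^n\log\big((1-\lambda)E_i^{(1)}+\lambda E_i^{(2)}\big)-\log W_n\le r_n\qquad(n\ge1)$$ $Q$-almost surely for every $Q\in\mathcal Q$, where $(r_n)$ is a deterministic real sequence with $r_n=o(n)$. Then for every $Q\in\mathcal Q$ the supremum $\ell_Q^\star$ is attained on $[0,1]$, and the following hold, where in (ii) and (iii) $\lambda_Q^\star\in\arg\max_{\lambda\in[0,1]}\ell_Q(\lambda)$ is any choice of maximizers. (i) $W$ is $\mathcal Q$-uniformly and universally log-optimal in $\mathcal W$: for every $W'\in\mathcal W$ and $\varepsilon>0$, $$\lim_{m\to\infty}\sup_{Q\in\mathcal Q}\mathbb P_Q\Big(\sup_{k\ge m}\tfrac1k\log(W_k'/W_k)\ge\varepsilon\Big)=0.$$ (ii) If $(a_n)$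 is a deterministic sequence with $\sum_{k}\exp\{-a_k\varepsilon/2\}<\infty$ for every $\varepsilon>0$ and $a_n^{-1}r_n\to0$, then $W$ and $W(\lambda_Q^\star)$ are $\mathcal Q$-uniformly asymptotically equivalent at a rate of $a_n/n$: for every $\varepsilon>0$, $$\lim_{m\to\infty}\sup_{Q\in\mathcal Q}\mathbb P_Q\Big(\sup_{k\ge m}a_k^{-1}\big|\log W_k-\log W_k(\lambda_Q^\star)\big|\ge\varepsilon\Big)=0.$$ (iii) Let $p\in[1,2)$ and let $\mathcal Q^\circ\subseteq\mathcal Q$ be any subset on which $L_Q^\star=\log((1-\lambda_Q^\star)E_1^{(1)}+\lambda_Q^\star E_1^{(2)})$ has a uniformly integrable $p$-th moment: $$\lim_{m\to\infty}\sup_{Q\in\mathcal Q^\circ}\mathbb E_Q\big[|L_Q^\star-\ell_Q^\star|^p\,\mathbf 1\{|L_Q^\star-\ell_Q^\star|^p\ge m\}\big]=0.$$ If moreover $r_n=o(n^{1/p})$, then $\frac1n\log W_n$ converges $\mathcal Q^\circ$-uniformly almost surely to $\ell_Q^\star$ at a rate of $o(n^{1/p-1})$: for every $\varepsilon>0$,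 $$\lim_{m\to\infty}\sup_{Q\in\mathcal Q^\circ}\mathbb P_Q\Big(\sup_{k\ge m}k^{1-1/p}\Big|\tfrac1k\log W_k-\ell_Q^\star\Big|\ge\varepsilon\Big)=0.$$ -/

import Mathlib

open MeasureTheory ProbabilityTheory Filter Topology Asymptotics
open scoped ENNReal

namespace PortfolioLogOpt

variable {Ω : Type*} [mΩ : MeasurableSpace Ω]

/-- The extended logarithm of a nonnegative real number, with `log 0 = -∞`. -/
noncomputable def elog (x : ℝ) : EReal := ENNReal.log (ENNReal.ofReal x)

/-- One-step return `(1 - l) e₁ + l e₂` of the portfolio with weight `l`. -/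
def mix (l e₁ e₂ : ℝ) : ℝ := (1 - l) * e₁ + l * e₂

/-- The wealth `∏_{i=1}^n ((1 - l_i) E_i^{(1)} + l_i E_i^{(2)})` of a betting strategy. -/
def wealth (E₁ E₂ : ℕ → Ω → ℝ) (l : ℕ → Ω → ℝ) (n : ℕ) (ω : Ω) : ℝ :=
  ∏ i ∈ Finset.Icc 1 n, mix (l i ω) (E₁ i ω) (E₂ i ω)

/-- A betting strategy: `[0, 1]`-valued, with `l_n` measurable at time `n - 1` for `n ≥ 1`. -/
def IsBettingStrategy (F : Filtration ℕ mΩ) (l : ℕ → Ω → ℝ) : Prop :=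
  (∀ n ω, l n ω ∈ Set.Icc (0 : ℝ) 1) ∧ ∀ n, Measurable[F n] (l (n + 1))

/-- Under `P`, the pairs `(E_n^{(1)}, E_n^{(2)})`, `n ≥ 1`, are almost surely nonnegative,
identically distributed, and each is independent of the information available before it
(so that, for an adapted sequence, the pairs are i.i.d.). -/
structure IsIIDNonneg (F : Filtration ℕ mΩ) (E₁ E₂ : ℕ → Ω → ℝ) (P : Measure Ω) : Prop where
  nonneg : ∀ n, 1 ≤ n → ∀ᵐ ω ∂P, 0 ≤ E₁ n ω ∧ 0 ≤ E₂ n ω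
  identDistrib : ∀ n, 1 ≤ n →
    IdentDistrib (fun ω => (E₁ n ω, E₂ n ω)) (fun ω => (E₁ 1 ω, E₂ 1 ω)) P P
  indep : ∀ n, Indep
    (MeasurableSpace.comap (fun ω => (E₁ (n + 1) ω, E₂ (n + 1) ω)) inferInstance) (F n) P

/-- `X` is an `e`-value under `P`: almost surely nonnegative, with mean at most one. -/
def IsEValue (P : Measure Ω) (X : Ω → ℝ) : Prop :=
  (∀ᵐ ω ∂P, 0 ≤ X ω) ∧ ∫⁻ ω, ENNReal.ofReal (X ω) ∂P ≤ 1

/-- The null hypothesis: the distributions under which the pairs are i.i.d. and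
`E_1^{(1)}`, `E_1^{(2)}` are both `e`-values. -/
def nullHyp (F : Filtration ℕ mΩ) (E₁ E₂ : ℕ → Ω → ℝ) : Set (Measure Ω) :=
  {P | IsProbabilityMeasure P ∧ IsIIDNonneg F E₁ E₂ P ∧
    IsEValue P (E₁ 1) ∧ IsEValue P (E₂ 1)}

/-- Test `𝒩`-supermartingales. -/
def IsTestSupermartingale (F : Filtration ℕ mΩ) (𝒩 : Set (Measure Ω)) (M : ℕ → Ω → ℝ) : Prop :=
  ∀ P ∈ 𝒩, Supermartingale M F P ∧ (∀ n, ∀ᵐ ω ∂P, 0 ≤ M n ω) ∧ ∫ ω, M 1 ω ∂P ≤ 1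

/-- The class `𝒲` of `e`-processes: nonnegative adapted processes `(W_n)_{n ≥ 1}` that are bounded
above by the wealth of some betting strategy, that wealth being a test supermartingale for the
null. The bound holds almost surely under each distribution of the null and of the
alternative `𝒬`. -/
def eProcessClass (F : Filtration ℕ mΩ) (E₁ E₂ : ℕ → Ω → ℝ) (𝒬 : Set (Measure Ω)) :
    Set (ℕ → Ω → ℝ) :=
  {W | (∀ n, 1 ≤ n → Measurable[F n] (W n)) ∧ (∀ n, 1 ≤ n → ∀ ω, 0 ≤ W n ω) ∧
    ∃ l : ℕ → Ω → ℝ, IsBettingStrategy F l ∧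
      IsTestSupermartingale F (nullHyp F E₁ E₂) (wealth E₁ E₂ l) ∧
      ∀ P ∈ nullHyp F E₁ E₂ ∪ 𝒬, ∀ n, 1 ≤ n → ∀ᵐ ω ∂P, W n ω ≤ wealth E₁ E₂ l n ω}

/-- The portfolio regret at time `n`, for given sequences `e₁`, `e₂` and final wealth `w`:
best log-wealth in hindsight over the constant rebalanced portfolios, minus `log w`. -/
noncomputable def regret (e₁ e₂ : ℕ → ℝ) (w : ℝ) (n : ℕ) : EReal :=
  (⨆ l ∈ Set.Icc (0 : ℝ) 1, ∑ i ∈ Finset.Icc 1 n, elog (mix l (e₁ i) (e₂ i))) - elog w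

/-- The expectation, in `[-∞, ∞]`, of an extended real random variable: expectation of the
positive part minus expectation of the negative part. -/
noncomputable def eexpect (Q : Measure Ω) (X : Ω → EReal) : EReal :=
  ((∫⁻ ω, (X ω).toENNReal ∂Q : ℝ≥0∞) : EReal) - ((∫⁻ ω, (-X ω).toENNReal ∂Q : ℝ≥0∞) : EReal)

/-- The log-increment `log ((1 - l) E_1^{(1)} + l E_1^{(2)})`. -/
noncomputable def logIncr (E₁ E₂ : ℕ → Ω → ℝ) (l : ℝ) (ω : Ω) : EReal :=
  elog (mix l (E₁ 1 ω) (E₂ 1 ω))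

/-- The growth rate `ℓ_Q(l) = E_Q log ((1 - l) E_1^{(1)} + l E_1^{(2)})`. -/
noncomputable def ell (E₁ E₂ : ℕ → Ω → ℝ) (Q : Measure Ω) (l : ℝ) : EReal :=
  eexpect Q (logIncr E₁ E₂ l)

/-- The optimal growth rate `ℓ_Q^⋆`, the supremum of `ℓ_Q` over `[0, 1]`. -/
noncomputable def ellStar (E₁ E₂ : ℕ → Ω → ℝ) (Q : Measure Ω) : EReal :=
  ⨆ l ∈ Set.Icc (0 : ℝ) 1, ell E₁ E₂ Q l

/-- `l` is a log-optimal portfolio under `Q`, i.e. `l ∈ argmax_{[0, 1]} ℓ_Q`. -/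
def IsLogOptimalPortfolio (E₁ E₂ : ℕ → Ω → ℝ) (Q : Measure Ω) (l : ℝ) : Prop :=
  l ∈ Set.Icc (0 : ℝ) 1 ∧ IsMaxOn (ell E₁ E₂ Q) (Set.Icc (0 : ℝ) 1) l

/-- `sup_{k ≥ m} Z_k ≥ ε` has probability tending to zero as `m → ∞`, uniformly in `Q ∈ 𝒬`, for
every `ε > 0`. The process `Z` may depend on `Q`. -/
def UnifEventuallySmall (𝒬 : Set (Measure Ω)) (Z : Measure Ω → ℕ → Ω → EReal) : Prop :=
  ∀ ε : ℝ, 0 < ε → Tendsto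
    (fun m : ℕ => ⨆ Q ∈ 𝒬, Q {ω | (ε : EReal) ≤ ⨆ k : ℕ, ⨆ _ : m ≤ k, Z Q k ω}) atTop (𝓝 0)

/-- `𝒬`-uniform and universal log-optimality of `W` in a class `𝒲`. -/
def IsUnifLogOptimal (𝒬 : Set (Measure Ω)) (𝒲 : Set (ℕ → Ω → ℝ)) (W : ℕ → Ω → ℝ) : Prop :=
  ∀ W' ∈ 𝒲, UnifEventuallySmall 𝒬
    (fun _ k ω => (((k : ℝ)⁻¹ : ℝ) : EReal) * (elog (W' k ω) - elog (W k ω)))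

/-- `𝒬`-uniform asymptotic equivalence, at a rate of `a_n / n`, of `W` and a process `V Q` that may
depend on `Q ∈ 𝒬`. -/
def IsUnifAsympEquiv (𝒬 : Set (Measure Ω)) (W : ℕ → Ω → ℝ) (V : Measure Ω → ℕ → Ω → ℝ)
    (a : ℕ → ℝ) : Prop :=
  UnifEventuallySmall 𝒬
    (fun Q k ω => (((a k)⁻¹ : ℝ) : EReal) * ((elog (W k ω) - elog (V Q k ω)).abs : EReal))

/-- `|L_Q^⋆ - ℓ_Q^⋆|^p`, where `L_Q^⋆` is the log-increment of the portfolio `l Q`. -/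
noncomputable def centeredPow (E₁ E₂ : ℕ → Ω → ℝ) (l : Measure Ω → ℝ) (p : ℝ)
    (Q : Measure Ω) (ω : Ω) : ℝ≥0∞ :=
  (logIncr E₁ E₂ (l Q) ω - ellStar E₁ E₂ Q).abs ^ p

/-- The log-increment of `l Q` has a `𝒬`-uniformly integrable `p`-th moment. -/
def HasUnifIntegrableMoment (E₁ E₂ : ℕ → Ω → ℝ) (l : Measure Ω → ℝ) (p : ℝ)
    (𝒬 : Set (Measure Ω)) : Prop :=
  Tendsto (fun m : ℕ => ⨆ Q ∈ 𝒬,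
    ∫⁻ ω in {ω | (m : ℝ≥0∞) ≤ centeredPow E₁ E₂ l p Q ω}, centeredPow E₁ E₂ l p Q ω ∂Q)
    atTop (𝓝 0)

end PortfolioLogOpt

open PortfolioLogOpt

/-! Fix `Q` and let V_k be the wealth at time k of a log-optimal constant portfolio λ*; everything
is compared with V.

Existence of λ*: every portfolio return is at most twice the equally weighted one, so the log-ratio
of these two is nonnegative. By Fatou its mean is lower semicontinuous in the weight, hence attains
a minimum on [0, 1].

Upper bound: the first-order condition at λ* (`lintegral_div_le_one`) says that each asset divided
by the λ* return has mean at most one. By independence the wealth of any betting strategy divided by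
V then has mean at most one at every time (`lintegral_wealth_div_wealth_le_one`), and Markov gives
Q(W'_k ≥ exp(c_k) V_k) ≤ exp(-c_k) for each W' in the class. This bound does not involve `Q`, so
Borel-Cantelli is uniform as soon as the exponentials are summable.

Lower bound: λ* competes in the maximum defining the regret, so log W_k ≥ log V_k - r_k almost
surely.

Claim (i) combines both bounds; claim (ii) applies the upper bound to W itself. For claim (iii), log
V_k is a sum of i.i.d. variables, and a uniform Marcinkiewicz-Zygmund law is needed. It comes from
truncation and Kolmogorov's maximal inequality on dyadic blocks: the resulting series of tail and
variance terms are summed under the integral sign and controlled by tails of the p-th moment, which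
are uniformly small. -/

namespace PortfolioLogOpt

variable {Ω : Type*} [mΩ : MeasurableSpace Ω]

/-! ### Extended logarithms and their expectations -/

lemma elog_of_pos {x : ℝ} (hx : 0 < x) : elog x = (Real.log x : ℝ) :=
  ENNReal.log_ofReal_of_pos hx

lemma elog_of_nonpos {x : ℝ} (hx : x ≤ 0) : elog x = ⊥ := by
  simp [elog, ENNReal.ofReal_of_nonpos hx]

lemma elog_ne_bot_iff {x : ℝ} : elog x ≠ ⊥ ↔ 0 < x := by
  simp [elog]

@[fun_prop]
lemma measurable_elog : Measurable elog :=
  ENNReal.log_monotone.measurable.comp ENNReal.measurable_ofReal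

@[fun_prop]
lemma measurable_toENNReal_ereal : Measurable EReal.toENNReal :=
  Monotone.measurable fun _ _ h => EReal.toENNReal_le_toENNReal h

lemma eexpect_elog_eq_integral {Q : Measure Ω} {f : Ω → ℝ} (hf : ∀ᵐ ω ∂Q, 0 < f ω)
    (hint : Integrable (fun ω => Real.log (f ω)) Q) :
    eexpect Q (fun ω => elog (f ω)) = ((∫ ω, Real.log (f ω) ∂Q : ℝ) : EReal) := by
  have h1 : ∫⁻ ω, (elog (f ω)).toENNReal ∂Q = ∫⁻ ω, ENNReal.ofReal (Real.log (f ω)) ∂Q :=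
    lintegral_congr_ae (hf.mono fun ω h => by simp [elog_of_pos h])
  have h2 : ∫⁻ ω, (-elog (f ω)).toENNReal ∂Q = ∫⁻ ω, ENNReal.ofReal (-Real.log (f ω)) ∂Q :=
    lintegral_congr_ae (hf.mono fun ω h => by
      simp only [elog_of_pos h, ← EReal.coe_neg, EReal.real_coe_toENNReal])
  have h3 : ∫⁻ ω, ENNReal.ofReal (Real.log (f ω)) ∂Q ≠ ⊤ := hint.lintegral_lt_top.ne
  have h4 : ∫⁻ ω, ENNReal.ofReal (-Real.log (f ω)) ∂Q ≠ ⊤ := hint.neg.lintegral_lt_top.ne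
  rw [eexpect, h1, h2, integral_eq_lintegral_pos_part_sub_lintegral_neg_part hint,
    EReal.coe_sub, EReal.coe_ennreal_toReal h3, EReal.coe_ennreal_toReal h4]

lemma eexpect_ne_bot {Q : Measure Ω} {X : Ω → EReal} (h : ∫⁻ ω, (-X ω).toENNReal ∂Q ≠ ⊤) :
    eexpect Q X ≠ ⊥ := by
  unfold eexpect
  lift ∫⁻ ω, (-X ω).toENNReal ∂Q to NNReal using h with b
  intro h'
  rw [sub_eq_add_neg, EReal.add_eq_bot_iff] at h'
  rcases h' with h' | h'
  · exact EReal.coe_ennreal_ne_bot _ h'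
  · rw [EReal.neg_eq_bot_iff, EReal.coe_ennreal_eq_top_iff] at h'
    exact ENNReal.coe_ne_top h'

/-- Passage from extended to real integrals: a finite expectation bounds both parts of the
logarithm, and a zero of `f` on a set of positive mass would make the negative part infinite. -/
lemma pos_and_integrable_log_of_eexpect_finite {Q : Measure Ω} {f : Ω → ℝ} (hf : Measurable f)
    (hbot : eexpect Q (fun ω => elog (f ω)) ≠ ⊥) (htop : eexpect Q (fun ω => elog (f ω)) ≠ ⊤) :
    (∀ᵐ ω ∂Q, 0 < f ω) ∧ Integrable (fun ω => Real.log (f ω)) Q := by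
  -- In `EReal`, subtracting `⊤` gives `⊥` even from `⊤`, so a value other than `⊥` already bounds
  -- the negative part.
  have hB : ∫⁻ ω, (-elog (f ω)).toENNReal ∂Q ≠ ⊤ := by
    intro h
    simp [eexpect, h] at hbot
  have hA : ∫⁻ ω, (elog (f ω)).toENNReal ∂Q ≠ ⊤ := by
    intro h
    apply htop
    rw [eexpect, h]
    lift ∫⁻ ω, (-elog (f ω)).toENNReal ∂Q to NNReal using hB with b
    rw [EReal.coe_ennreal_top]
    exact EReal.top_sub_coe b
  have hpos : ∀ᵐ ω ∂Q, 0 < f ω := by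
    filter_upwards [ae_lt_top (by fun_prop) hB] with ω hω
    rw [← elog_ne_bot_iff]
    intro h
    simp [h] at hω
  refine ⟨hpos, (Real.measurable_log.comp hf).aestronglyMeasurable, ?_⟩
  rw [hasFiniteIntegral_iff_norm]
  calc ∫⁻ ω, ENNReal.ofReal ‖Real.log (f ω)‖ ∂Q
      ≤ ∫⁻ ω, ((elog (f ω)).toENNReal + (-elog (f ω)).toENNReal) ∂Q := by
        refine lintegral_mono_ae (hpos.mono fun ω h => ?_)
        rw [elog_of_pos h, ← EReal.coe_neg, EReal.real_coe_toENNReal, EReal.real_coe_toENNReal,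
          Real.norm_eq_abs]
        rcases le_total 0 (Real.log (f ω)) with h0 | h0
        · rw [abs_of_nonneg h0]; exact le_self_add
        · rw [abs_of_nonpos h0]; exact le_add_self
    _ = _ := lintegral_add_left (by fun_prop) _
    _ < ⊤ := ENNReal.add_lt_top.2 ⟨hA.lt_top, hB.lt_top⟩

/-- The negative part of log f is dominated by that of the integrable log c + log g. The positive
part may be infinite, which does no harm since only `⊥` is excluded. -/
lemma eexpect_elog_ne_bot_of_ge {Q : Measure Ω} [IsFiniteMeasure Q] {f g : Ω → ℝ} {c : ℝ}
    (hc : 0 < c) (hg : ∀ᵐ ω ∂Q, 0 < g ω) (hint : Integrable (fun ω => Real.log (g ω)) Q)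
    (hfg : ∀ᵐ ω ∂Q, c * g ω ≤ f ω) : eexpect Q (fun ω => elog (f ω)) ≠ ⊥ := by
  apply eexpect_ne_bot
  refine ne_top_of_le_ne_top
    ((integrable_const (-Real.log c)).sub hint).lintegral_lt_top.ne (lintegral_mono_ae ?_)
  filter_upwards [hg, hfg] with ω h1 h2
  have h3 : 0 < c * g ω := mul_pos hc h1
  rw [elog_of_pos (h3.trans_le h2), ← EReal.coe_neg, EReal.real_coe_toENNReal]
  apply ENNReal.ofReal_le_ofReal
  have := Real.log_le_log h3 h2
  rw [Real.log_mul hc.ne' h1.ne'] at this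
  simp only [Pi.sub_apply]
  linarith

lemma measurable_mix {f g : Ω → ℝ} (hf : Measurable f) (hg : Measurable g) (l : ℝ) :
    Measurable (fun ω => mix l (f ω) (g ω)) := by
  unfold mix; fun_prop

lemma mix_nonneg {l a b : ℝ} (hl : l ∈ Set.Icc (0 : ℝ) 1) (ha : 0 ≤ a) (hb : 0 ≤ b) :
    0 ≤ mix l a b :=
  add_nonneg (mul_nonneg (by linarith [hl.2]) ha) (mul_nonneg hl.1 hb)

/-- Both weights of `l` are at most 1, twice those of the equal split. This makes the equally
weighted portfolio a common dominating reference. -/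
lemma half_mix_le_mix_half {l a b : ℝ} (hl : l ∈ Set.Icc (0 : ℝ) 1) (ha : 0 ≤ a) (hb : 0 ≤ b) :
    1 / 2 * mix l a b ≤ mix (1 / 2) a b := by
  unfold mix
  nlinarith [mul_nonneg hl.1 ha, mul_nonneg (sub_nonneg.2 hl.2) hb]

/-! ### Existence of a log-optimal portfolio -/

section Portfolio

variable {E₁ E₂ : ℕ → Ω → ℝ} {Q : Measure Ω}

lemma ell_le_ellStar {l : ℝ} (hl : l ∈ Set.Icc (0 : ℝ) 1) :
    ell E₁ E₂ Q l ≤ ellStar E₁ E₂ Q :=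
  le_iSup₂ (f := fun l (_ : l ∈ Set.Icc (0 : ℝ) 1) => ell E₁ E₂ Q l) l hl

lemma IsLogOptimalPortfolio.ell_eq {l : ℝ} (h : IsLogOptimalPortfolio E₁ E₂ Q l) :
    ell E₁ E₂ Q l = ellStar E₁ E₂ Q :=
  le_antisymm (ell_le_ellStar h.1) (iSup₂_le fun _ hl' => h.2 hl')

/-- Under a finite optimal growth rate, the equally weighted portfolio has a finite growth rate. -/
lemma ell_half_ne_bot [IsFiniteMeasure Q] (hE₁ : Measurable (E₁ 1)) (hE₂ : Measurable (E₂ 1))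
    (hnn : ∀ᵐ ω ∂Q, 0 ≤ E₁ 1 ω ∧ 0 ≤ E₂ 1 ω)
    (hbot : ⊥ < ellStar E₁ E₂ Q) (htop : ellStar E₁ E₂ Q < ⊤) :
    ell E₁ E₂ Q (1 / 2) ≠ ⊥ := by
  obtain ⟨l, hl, hl'⟩ : ∃ l ∈ Set.Icc (0 : ℝ) 1, ⊥ < ell E₁ E₂ Q l := by
    simpa [ellStar, lt_iSup_iff, and_assoc] using hbot
  obtain ⟨h1, h2⟩ := pos_and_integrable_log_of_eexpect_finite (measurable_mix hE₁ hE₂ l)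
    hl'.ne' ((ell_le_ellStar hl).trans_lt htop).ne
  exact eexpect_elog_ne_bot_of_ge (c := 1 / 2) (by norm_num) h1 h2
    (hnn.mono fun ω h => half_mix_le_mix_half hl h.1 h.2)

/-- Maximizing the growth rate amounts to minimizing the mean of the log-ratio of twice the equally
weighted return to the return of `l`. That ratio is at least one, so Fatou applies, and no upper
semicontinuity of the growth rate has to be proved directly. -/
theorem exists_isLogOptimalPortfolio [IsProbabilityMeasure Q] (hE₁ : Measurable (E₁ 1))
    (hE₂ : Measurable (E₂ 1)) (hnn : ∀ᵐ ω ∂Q, 0 ≤ E₁ 1 ω ∧ 0 ≤ E₂ 1 ω)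
    (hbot : ⊥ < ellStar E₁ E₂ Q) (htop : ellStar E₁ E₂ Q < ⊤) :
    ∃ l, IsLogOptimalPortfolio E₁ E₂ Q l := by
  have hhalf : (1 / 2 : ℝ) ∈ Set.Icc (0 : ℝ) 1 := by norm_num
  obtain ⟨hS, hSint⟩ := pos_and_integrable_log_of_eexpect_finite (measurable_mix hE₁ hE₂ (1 / 2))
    (ell_half_ne_bot hE₁ hE₂ hnn hbot htop) ((ell_le_ellStar hhalf).trans_lt htop).ne
  -- `G l` is the shortfall of the growth rate of `l`, up to a constant
  let D : ℝ → Ω → ℝ≥0∞ := fun l ω =>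
    (ENNReal.log (ENNReal.ofReal (2 * mix (1 / 2) (E₁ 1 ω) (E₂ 1 ω)) /
      ENNReal.ofReal (mix l (E₁ 1 ω) (E₂ 1 ω)))).toENNReal
  let G : ℝ → ℝ≥0∞ := fun l => ∫⁻ ω, D l ω ∂Q
  have hDmeas : ∀ l, Measurable (D l) := fun l => by
    have h1 := measurable_mix hE₁ hE₂ (1 / 2)
    have h2 := measurable_mix hE₁ hE₂ l
    exact measurable_toENNReal_ereal.comp (ENNReal.log_monotone.measurable.comp (by fun_prop))
  have hDreal : ∀ l ∈ Set.Icc (0 : ℝ) 1, ∀ ω, 0 ≤ E₁ 1 ω ∧ 0 ≤ E₂ 1 ω →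
      0 < mix l (E₁ 1 ω) (E₂ 1 ω) → 0 < mix (1 / 2) (E₁ 1 ω) (E₂ 1 ω) →
      0 ≤ Real.log 2 + Real.log (mix (1 / 2) (E₁ 1 ω) (E₂ 1 ω)) -
        Real.log (mix l (E₁ 1 ω) (E₂ 1 ω)) ∧
      D l ω = ENNReal.ofReal (Real.log 2 + Real.log (mix (1 / 2) (E₁ 1 ω) (E₂ 1 ω)) -
        Real.log (mix l (E₁ 1 ω) (E₂ 1 ω))) := by
    intro l hl ω h h1 h2
    constructor
    · rw [← Real.log_mul two_ne_zero h2.ne', sub_nonneg]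
      apply Real.log_le_log h1
      linarith [half_mix_le_mix_half hl h.1 h.2]
    · simp only [D]
      rw [← ENNReal.ofReal_div_of_pos h1, ENNReal.log_ofReal_of_pos (by positivity),
        EReal.real_coe_toENNReal, Real.log_div (by positivity) h1.ne',
        Real.log_mul two_ne_zero h2.ne']
  have hGint : ∀ l ∈ Set.Icc (0 : ℝ) 1, ell E₁ E₂ Q l ≠ ⊥ → G l ≠ ⊤ ∧
      ell E₁ E₂ Q l = ((Real.log 2 + ∫ ω, Real.log (mix (1 / 2) (E₁ 1 ω) (E₂ 1 ω)) ∂Q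
        - (G l).toReal : ℝ) : EReal) := by
    intro l hl hne
    obtain ⟨h1, h2⟩ := pos_and_integrable_log_of_eexpect_finite (measurable_mix hE₁ hE₂ l)
      hne ((ell_le_ellStar hl).trans_lt htop).ne
    have hi : Integrable (fun ω => Real.log 2 + Real.log (mix (1 / 2) (E₁ 1 ω) (E₂ 1 ω)) -
        Real.log (mix l (E₁ 1 ω) (E₂ 1 ω))) Q := ((integrable_const _).add hSint).sub h2
    have hG : G l = ENNReal.ofReal (∫ ω, (Real.log 2 +
        Real.log (mix (1 / 2) (E₁ 1 ω) (E₂ 1 ω)) - Real.log (mix l (E₁ 1 ω) (E₂ 1 ω))) ∂Q) := by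
      rw [ofReal_integral_eq_lintegral_ofReal hi]
      · apply lintegral_congr_ae
        filter_upwards [hnn, h1, hS] with ω a b c using (hDreal l hl ω a b c).2
      · filter_upwards [hnn, h1, hS] with ω a b c using (hDreal l hl ω a b c).1
    refine ⟨hG ▸ ENNReal.ofReal_ne_top, ?_⟩
    have hnn' : 0 ≤ ∫ ω, (Real.log 2 + Real.log (mix (1 / 2) (E₁ 1 ω) (E₂ 1 ω)) -
        Real.log (mix l (E₁ 1 ω) (E₂ 1 ω))) ∂Q := by
      apply integral_nonneg_of_ae
      filter_upwards [hnn, h1, hS] with ω a b c using (hDreal l hl ω a b c).1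
    have hsplit : ∫ ω, (Real.log 2 + Real.log (mix (1 / 2) (E₁ 1 ω) (E₂ 1 ω)) -
        Real.log (mix l (E₁ 1 ω) (E₂ 1 ω))) ∂Q = Real.log 2 +
        ∫ ω, Real.log (mix (1 / 2) (E₁ 1 ω) (E₂ 1 ω)) ∂Q -
        ∫ ω, Real.log (mix l (E₁ 1 ω) (E₂ 1 ω)) ∂Q := by
      rw [integral_sub (f := fun ω => Real.log 2 + Real.log (mix (1 / 2) (E₁ 1 ω) (E₂ 1 ω)))
        ((integrable_const _).add hSint) h2, integral_add (integrable_const _) hSint]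
      simp
    rw [hG, ENNReal.toReal_ofReal hnn', hsplit, sub_sub_cancel]
    exact eexpect_elog_eq_integral h1 h2
  -- For almost every outcome the shortfall is continuous in the weight, with value `⊤` where the
  -- return of `l` vanishes: the numerator is positive and finite there. Fatou transfers lower
  -- semicontinuity to the integral.
  have hlsc : LowerSemicontinuousOn G (Set.Icc 0 1) := by
    refine fun l hl => lowerSemicontinuousWithinAt_iff_le_liminf.2 ?_
    refine le_trans (lintegral_mono_ae ?_) (lintegral_liminf_le hDmeas)
    filter_upwards [hS] with ω hω
    have hc : Continuous fun l => D l ω := by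
      refine EReal.continuous_toENNReal.comp (ENNReal.continuous_log.comp ?_)
      have hm : Continuous fun l => ENNReal.ofReal (mix l (E₁ 1 ω) (E₂ 1 ω)) := by
        unfold mix; exact ENNReal.continuous_ofReal.comp (by fun_prop)
      rw [continuous_iff_continuousAt]
      intro x
      refine ENNReal.Tendsto.div tendsto_const_nhds (Or.inl ?_) (hm.tendsto x)
        (Or.inr ENNReal.ofReal_ne_top)
      simpa using hω
    exact (hc.lowerSemicontinuous.lowerSemicontinuousWithinAt _ l).le_liminf
  obtain ⟨l, hl, hmin⟩ := LowerSemicontinuousOn.exists_isMinOn ⟨1 / 2, hhalf⟩ isCompact_Icc hlsc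
  have hGl : G l ≠ ⊤ := ne_top_of_le_ne_top
    (hGint _ hhalf (ell_half_ne_bot hE₁ hE₂ hnn hbot htop)).1 (hmin hhalf)
  have hlpos : ∀ᵐ ω ∂Q, 0 < mix l (E₁ 1 ω) (E₂ 1 ω) := by
    filter_upwards [ae_lt_top (hDmeas l) hGl, hS] with ω h1 h2
    by_contra h3
    have : ENNReal.ofReal (2 * mix (1 / 2) (E₁ 1 ω) (E₂ 1 ω)) ≠ 0 := by simpa using h2
    simp only [D] at h1
    rw [ENNReal.ofReal_of_nonpos (not_lt.1 h3), ENNReal.div_zero this] at h1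
    simp at h1
  have hlint : Integrable (fun ω => Real.log (mix l (E₁ 1 ω) (E₂ 1 ω))) Q := by
    have hm : Measurable fun ω => Real.log (mix l (E₁ 1 ω) (E₂ 1 ω)) :=
      Real.measurable_log.comp (measurable_mix hE₁ hE₂ l)
    have hi : Integrable (fun ω => Real.log 2 + Real.log (mix (1 / 2) (E₁ 1 ω) (E₂ 1 ω)) -
        Real.log (mix l (E₁ 1 ω) (E₂ 1 ω))) Q := by
      refine ⟨((integrable_const _).add hSint).1.sub hm.aestronglyMeasurable, ?_⟩
      rw [hasFiniteIntegral_iff_ofReal]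
      · refine lt_of_eq_of_lt (lintegral_congr_ae ?_) hGl.lt_top
        filter_upwards [hnn, hlpos, hS] with ω a b c using (hDreal l hl ω a b c).2.symm
      · filter_upwards [hnn, hlpos, hS] with ω a b c using (hDreal l hl ω a b c).1
    refine (((integrable_const (Real.log 2)).add hSint).sub hi).congr (ae_of_all _ fun ω => ?_)
    simp
  have hlbot : ell E₁ E₂ Q l ≠ ⊥ := by
    change eexpect Q (fun ω => elog (mix l (E₁ 1 ω) (E₂ 1 ω))) ≠ ⊥
    rw [eexpect_elog_eq_integral hlpos hlint]
    exact EReal.coe_ne_bot _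
  refine ⟨l, hl, fun l' hl' => ?_⟩
  simp only [Set.mem_ofPred_eq]
  by_cases h : ell E₁ E₂ Q l' = ⊥
  · rw [h]; exact bot_le
  · rw [(hGint l hl hlbot).2, (hGint l' hl' h).2, EReal.coe_le_coe_iff]
    gcongr
    · exact (hGint l' hl' h).1
    · exact hmin hl'

end Portfolio

/-! ### The Kuhn-Tucker condition and the numeraire property -/

/-- If the log-return of `g` cannot be improved by mixing in `f`, then `f / g` has mean at most
one (the Kuhn-Tucker condition). -/
theorem lintegral_div_le_one {Q : Measure Ω} [IsProbabilityMeasure Q] {f g : Ω → ℝ}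
    (hf : Measurable f) (hg : Measurable g) (hf0 : ∀ᵐ ω ∂Q, 0 ≤ f ω) (hg0 : ∀ᵐ ω ∂Q, 0 < g ω)
    (hgint : Integrable (fun ω => Real.log (g ω)) Q)
    (hmax : ∀ t ∈ Set.Ioo (0 : ℝ) 1, eexpect Q (fun ω => elog ((1 - t) * g ω + t * f ω)) ≤
      ((∫ ω, Real.log (g ω) ∂Q : ℝ) : EReal)) :
    ∫⁻ ω, ENNReal.ofReal (f ω / g ω) ∂Q ≤ 1 := by
  -- The shift by 2 keeps `t n` inside (0, 1) from n = 0 on.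
  let t : ℕ → ℝ := fun n => ((n : ℝ) + 2)⁻¹
  have ht : ∀ n, t n ∈ Set.Ioo (0 : ℝ) 1 := fun n =>
    ⟨by positivity, inv_lt_one_of_one_lt₀ (by linarith [n.cast_nonneg (α := ℝ)])⟩
  let h : ℕ → Ω → ℝ := fun n ω => (1 - t n) * g ω + t n * f ω
  have hhm : ∀ n, Measurable (h n) := fun n => by fun_prop
  have hge : ∀ n, ∀ᵐ ω ∂Q, (1 - t n) * g ω ≤ h n ω := fun n => hf0.mono fun ω hω =>
    le_add_of_nonneg_right (mul_nonneg (ht n).1.le hω)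
  have hh : ∀ n, (∀ᵐ ω ∂Q, 0 < h n ω) ∧ Integrable (fun ω => Real.log (h n ω)) Q := fun n =>
    pos_and_integrable_log_of_eexpect_finite (hhm n)
      (eexpect_elog_ne_bot_of_ge (sub_pos.2 (ht n).2) hg0 hgint (hge n))
      ((hmax _ (ht n)).trans_lt (EReal.coe_lt_top _)).ne
  have hle : ∀ n, ∫ ω, Real.log (h n ω) ∂Q ≤ ∫ ω, Real.log (g ω) ∂Q := fun n => by
    rw [← EReal.coe_le_coe_iff, ← eexpect_elog_eq_integral (hh n).1 (hh n).2]
    exact hmax _ (ht n)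
  -- Difference quotients of the log-return at t = 0. By log x ≥ 1 - 1/x they are at least -(n +
  -- 2)/(n + 1) ≥ -2, so adding 2 makes them nonnegative for Fatou. Their integrals stay at most 2
  -- by optimality of `g`, while the pointwise limit is f/g - 1 + 2.
  let Z : ℕ → Ω → ℝ := fun n ω => ((n : ℝ) + 2) * (Real.log (h n ω) - Real.log (g ω)) + 2
  have hZint : ∀ n, Integrable (Z n) Q := fun n =>
    (((hh n).2.sub hgint).const_mul _).add (integrable_const _)
  have hZ0 : ∀ n, 0 ≤ᵐ[Q] Z n := fun n => by
    filter_upwards [hge n, hg0] with ω h1 h2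
    have h3 := sub_pos.2 (ht n).2
    have h4 : Real.log (1 - t n) + Real.log (g ω) ≤ Real.log (h n ω) := by
      rw [← Real.log_mul h3.ne' h2.ne']
      exact Real.log_le_log (mul_pos h3 h2) h1
    have h5 := Real.one_sub_inv_le_log_of_pos h3
    have hn : (0 : ℝ) ≤ n := n.cast_nonneg
    have h6 : ((n : ℝ) + 2) * (1 - (1 - t n)⁻¹) + 2 = n / (n + 1) := by
      have : 1 - t n = (n + 1) / (n + 2) := by simp only [t]; field_simp; ring
      rw [this, inv_div]; field_simp; ring
    have h7 : (0 : ℝ) ≤ n / (n + 1) := by positivity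
    have h8 : ((n : ℝ) + 2) * (1 - (1 - t n)⁻¹) ≤
        ((n : ℝ) + 2) * (Real.log (h n ω) - Real.log (g ω)) :=
      mul_le_mul_of_nonneg_left (by linarith) (by linarith)
    simp only [Z, Pi.zero_apply]
    linarith
  have hZle : ∀ n, ∫⁻ ω, ENNReal.ofReal (Z n ω) ∂Q ≤ 2 := fun n => by
    rw [← ofReal_integral_eq_lintegral_ofReal (hZint n) (hZ0 n)]
    rw [show (2 : ℝ≥0∞) = ENNReal.ofReal 2 by simp]
    apply ENNReal.ofReal_le_ofReal
    have hsplit : ∫ ω, Z n ω ∂Q = ((n : ℝ) + 2) *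
        (∫ ω, Real.log (h n ω) ∂Q - ∫ ω, Real.log (g ω) ∂Q) + 2 := by
      rw [← integral_sub (hh n).2 hgint, ← integral_const_mul,
        integral_add (f := fun ω => ((n : ℝ) + 2) * (Real.log (h n ω) - Real.log (g ω)))
          (((hh n).2.sub hgint).const_mul _) (integrable_const _)]
      simp
    rw [hsplit]
    have : ((n : ℝ) + 2) * (∫ ω, Real.log (h n ω) ∂Q - ∫ ω, Real.log (g ω) ∂Q) ≤ 0 :=
      mul_nonpos_of_nonneg_of_nonpos (by positivity) (sub_nonpos.2 (hle n))
    linarith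
  have hlim : ∀ᵐ ω ∂Q, ENNReal.ofReal (f ω / g ω) + 1 ≤
      liminf (fun n => ENNReal.ofReal (Z n ω)) atTop := by
    filter_upwards [hf0, hg0, ae_all_iff.2 fun n => (hh n).1] with ω h1 h2 h3
    have h4 : Tendsto (fun n : ℕ => (n : ℝ) + 2) atTop atTop :=
      tendsto_atTop_add_const_right _ _ tendsto_natCast_atTop_atTop
    have h5 := ((Real.tendsto_mul_log_one_add_div_atTop (f ω / g ω - 1)).comp h4).add_const 2
    have h6 : Tendsto (fun n => Z n ω) atTop (𝓝 (f ω / g ω - 1 + 2)) := by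
      refine h5.congr fun n => ?_
      simp only [Z, Function.comp]
      rw [← Real.log_div (h3 n).ne' h2.ne']
      congr 3
      simp only [h, t]
      field_simp
      ring
    rw [(ENNReal.tendsto_ofReal h6).liminf_eq,
      ← ENNReal.ofReal_one, ← ENNReal.ofReal_add (div_nonneg h1 h2.le) zero_le_one]
    exact ENNReal.ofReal_le_ofReal (by linarith)
  have hfin : ∫⁻ ω, ENNReal.ofReal (f ω / g ω) ∂Q + 1 ≤ 1 + 1 := by
    calc ∫⁻ ω, ENNReal.ofReal (f ω / g ω) ∂Q + 1
        = ∫⁻ ω, (ENNReal.ofReal (f ω / g ω) + 1) ∂Q := by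
          rw [lintegral_add_right _ measurable_const]; simp
      _ ≤ ∫⁻ ω, liminf (fun n => ENNReal.ofReal (Z n ω)) atTop ∂Q := lintegral_mono_ae hlim
      _ ≤ liminf (fun n => ∫⁻ ω, ENNReal.ofReal (Z n ω) ∂Q) atTop :=
          lintegral_liminf_le' fun n => (hZint n).1.aemeasurable.ennreal_ofReal
      _ ≤ liminf (fun _ : ℕ => (2 : ℝ≥0∞)) atTop :=
          liminf_le_liminf (Eventually.of_forall hZle)
      _ = 1 + 1 := by rw [liminf_const, one_add_one_eq_two]
  exact (ENNReal.add_le_add_iff_right ENNReal.one_ne_top).1 hfin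

section Portfolio

variable {F : Filtration ℕ mΩ} {E₁ E₂ : ℕ → Ω → ℝ} {Q : Measure Ω}

lemma IsIIDNonneg.ae_of_ae_one (h : IsIIDNonneg F E₁ E₂ Q) {p : ℝ × ℝ → Prop}
    (hp : MeasurableSet {x | p x}) (h1 : ∀ᵐ ω ∂Q, p (E₁ 1 ω, E₂ 1 ω)) {n : ℕ} (hn : 1 ≤ n) :
    ∀ᵐ ω ∂Q, p (E₁ n ω, E₂ n ω) :=
  (h.identDistrib n hn).symm.ae_snd hp h1

lemma IsIIDNonneg.lintegral_eq (h : IsIIDNonneg F E₁ E₂ Q) {φ : ℝ × ℝ → ℝ≥0∞}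
    (hφ : Measurable φ) {n : ℕ} (hn : 1 ≤ n) :
    ∫⁻ ω, φ (E₁ n ω, E₂ n ω) ∂Q = ∫⁻ ω, φ (E₁ 1 ω, E₂ 1 ω) ∂Q :=
  ((h.identDistrib n hn).comp hφ).lintegral_eq

lemma IsLogOptimalPortfolio.pos_and_integrable {l : ℝ} (h : IsLogOptimalPortfolio E₁ E₂ Q l)
    (hE₁ : Measurable (E₁ 1)) (hE₂ : Measurable (E₂ 1)) (hbot : ⊥ < ellStar E₁ E₂ Q)
    (htop : ellStar E₁ E₂ Q < ⊤) :
    (∀ᵐ ω ∂Q, 0 < mix l (E₁ 1 ω) (E₂ 1 ω)) ∧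
      Integrable (fun ω => Real.log (mix l (E₁ 1 ω) (E₂ 1 ω))) Q ∧
      ellStar E₁ E₂ Q = ((∫ ω, Real.log (mix l (E₁ 1 ω) (E₂ 1 ω)) ∂Q : ℝ) : EReal) := by
  have h' := h.ell_eq
  obtain ⟨h1, h2⟩ := pos_and_integrable_log_of_eexpect_finite (Q := Q) (measurable_mix hE₁ hE₂ l)
    (h'.symm ▸ hbot).ne' (h'.symm ▸ htop).ne
  exact ⟨h1, h2, h' ▸ eexpect_elog_eq_integral h1 h2⟩

/-- The two assets have mean at most one relative to a log-optimal portfolio. -/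
lemma IsLogOptimalPortfolio.lintegral_div_le_one [IsProbabilityMeasure Q] {l : ℝ}
    (h : IsLogOptimalPortfolio E₁ E₂ Q l)
    (hE₁ : Measurable (E₁ 1)) (hE₂ : Measurable (E₂ 1))
    (hnn : ∀ᵐ ω ∂Q, 0 ≤ E₁ 1 ω ∧ 0 ≤ E₂ 1 ω) (hbot : ⊥ < ellStar E₁ E₂ Q)
    (htop : ellStar E₁ E₂ Q < ⊤) :
    ∫⁻ ω, ENNReal.ofReal (E₁ 1 ω / mix l (E₁ 1 ω) (E₂ 1 ω)) ∂Q ≤ 1 ∧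
      ∫⁻ ω, ENNReal.ofReal (E₂ 1 ω / mix l (E₁ 1 ω) (E₂ 1 ω)) ∂Q ≤ 1 := by
  obtain ⟨h1, h2, h3⟩ := h.pos_and_integrable hE₁ hE₂ hbot htop
  -- Mixing two constant portfolios gives a constant portfolio, so no mixture beats λ*. The choices
  -- l' = 0 and l' = 1 are the single assets.
  have key : ∀ l' ∈ Set.Icc (0 : ℝ) 1, ∀ t ∈ Set.Ioo (0 : ℝ) 1,
      eexpect Q (fun ω => elog ((1 - t) * mix l (E₁ 1 ω) (E₂ 1 ω) + t * mix l' (E₁ 1 ω) (E₂ 1 ω)))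
        ≤ ((∫ ω, Real.log (mix l (E₁ 1 ω) (E₂ 1 ω)) ∂Q : ℝ) : EReal) := by
    intro l' hl' t ht
    rw [← h3]
    have hmem : (1 - t) * l + t * l' ∈ Set.Icc (0 : ℝ) 1 :=
      (convex_Icc (0 : ℝ) 1) h.1 hl' (sub_nonneg.2 ht.2.le) ht.1.le (by ring)
    refine le_trans (le_of_eq ?_) (ell_le_ellStar hmem)
    unfold ell logIncr
    congr! 3 with ω
    unfold mix; ring
  constructor
  · refine PortfolioLogOpt.lintegral_div_le_one hE₁ (measurable_mix hE₁ hE₂ l)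
      (hnn.mono fun ω h => h.1) h1 h2 fun t ht => ?_
    simpa [mix] using key 0 (by simp) t ht
  · refine PortfolioLogOpt.lintegral_div_le_one hE₂ (measurable_mix hE₁ hE₂ l)
      (hnn.mono fun ω h => h.2) h1 h2 fun t ht => ?_
    simpa [mix] using key 1 (by simp) t ht

variable (hE : ∀ n, 1 ≤ n → Measurable[F n] (E₁ n) ∧ Measurable[F n] (E₂ n))
include hE

/-- Relative to a log-optimal constant portfolio, the wealth of any betting strategy has mean at
most one. -/
theorem lintegral_wealth_div_wealth_le_one [IsProbabilityMeasure Q] (hiid : IsIIDNonneg F E₁ E₂ Q)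
    (hbot : ⊥ < ellStar E₁ E₂ Q) (htop : ellStar E₁ E₂ Q < ⊤) {lstar : ℝ}
    (hl : IsLogOptimalPortfolio E₁ E₂ Q lstar) {l : ℕ → Ω → ℝ} (hbet : IsBettingStrategy F l)
    (k : ℕ) :
    ∫⁻ ω, ENNReal.ofReal (wealth E₁ E₂ l k ω / wealth E₁ E₂ (fun _ _ => lstar) k ω) ∂Q ≤ 1 := by
  have hE1 := fun n hn => (hE n hn).1.mono (F.le n) le_rfl
  have hE2 := fun n hn => (hE n hn).2.mono (F.le n) le_rfl
  let φ₁ : ℝ × ℝ → ℝ≥0∞ := fun x => ENNReal.ofReal (x.1 / mix lstar x.1 x.2)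
  let φ₂ : ℝ × ℝ → ℝ≥0∞ := fun x => ENNReal.ofReal (x.2 / mix lstar x.1 x.2)
  have hm : Measurable fun x : ℝ × ℝ => mix lstar x.1 x.2 := by unfold mix; fun_prop
  have hφ₁ : Measurable φ₁ := (measurable_fst.div hm).ennreal_ofReal
  have hφ₂ : Measurable φ₂ := (measurable_snd.div hm).ennreal_ofReal
  let e : ℕ → Ω → ℝ × ℝ := fun n ω => (E₁ n ω, E₂ n ω)
  have he : ∀ n, 1 ≤ n → Measurable[F n] (e n) := fun n hn => (hE n hn).1.prodMk (hE n hn).2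
  have hlm : ∀ n, Measurable[F n] (l (n + 1)) := hbet.2
  -- The wealth ratio, factor by factor, as a weighted mean of the two relative returns. Working in
  -- `ℝ≥0∞` avoids any integrability question.
  let R : ℕ → Ω → ℝ≥0∞ := fun n ω => ∏ i ∈ Finset.Icc 1 n,
    (ENNReal.ofReal (1 - l i ω) * φ₁ (e i ω) + ENNReal.ofReal (l i ω) * φ₂ (e i ω))
  have hRm : ∀ n, Measurable[F n] (R n) := by
    intro n
    refine Finset.measurable_prod _ fun i hi => ?_
    obtain ⟨h1, h2⟩ := Finset.mem_Icc.1 hi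
    obtain ⟨j, rfl⟩ := Nat.exists_eq_add_of_le' h1
    have hl' : Measurable[F n] (l (j + 1)) := (hlm j).mono (F.mono (by omega)) le_rfl
    have he' : Measurable[F n] (e (j + 1)) := (he _ h1).mono (F.mono h2) le_rfl
    exact ((measurable_const.sub hl').ennreal_ofReal.mul (hφ₁.comp he')).add
      (hl'.ennreal_ofReal.mul (hφ₂.comp he'))
  obtain ⟨hd1, hd2⟩ := hl.lintegral_div_le_one (hE1 1 le_rfl) (hE2 1 le_rfl)
    (hiid.nonneg 1 le_rfl) hbot htop
  have hpos := (hl.pos_and_integrable (hE1 1 le_rfl) (hE2 1 le_rfl) hbot htop).1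
  have hRle : ∀ n, ∫⁻ ω, R n ω ∂Q ≤ 1 := by
    intro n
    induction n with
    | zero => simp [R]
    | succ n ih =>
      have hsucc : ∀ ω, R (n + 1) ω = R n ω * ENNReal.ofReal (1 - l (n + 1) ω) * φ₁ (e (n + 1) ω)
          + R n ω * ENNReal.ofReal (l (n + 1) ω) * φ₂ (e (n + 1) ω) := fun ω => by
        simp only [R]
        rw [← Finset.insert_Icc_right_eq_Icc_add_one (by omega),
          Finset.prod_insert (by simp)]
        ring
      have hm1 : Measurable[F n] fun ω => R n ω * ENNReal.ofReal (1 - l (n + 1) ω) :=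
        (hRm n).mul (measurable_const.sub (hlm n)).ennreal_ofReal
      have hm2 : Measurable[F n] fun ω => R n ω * ENNReal.ofReal (l (n + 1) ω) :=
        (hRm n).mul (hlm n).ennreal_ofReal
      have hen : Measurable (e (n + 1)) := (he _ (by omega)).mono (F.le _) le_rfl
      -- One step of the supermartingale property: a factor known at time n is independent of the
      -- next pair, whose relative return has mean at most one. The two weights then add up to 1.
      have hprod : ∀ (ψ : Ω → ℝ≥0∞) (φ : ℝ × ℝ → ℝ≥0∞), Measurable[F n] ψ → Measurable φ →
          ∫⁻ ω, φ (E₁ 1 ω, E₂ 1 ω) ∂Q ≤ 1 →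
          ∫⁻ ω, ψ ω * φ (e (n + 1) ω) ∂Q ≤ ∫⁻ ω, ψ ω ∂Q := by
        intro ψ φ hψ hφ hle
        rw [lintegral_mul_eq_lintegral_mul_lintegral_of_independent_measurableSpace
          (g := fun ω => φ (e (n + 1) ω)) (F.le n) hen.comap_le (hiid.indep n).symm hψ (hφ.comp (comap_measurable _)),
          hiid.lintegral_eq hφ (by omega)]
        exact mul_le_of_le_one_right' hle
      calc ∫⁻ ω, R (n + 1) ω ∂Q
          = ∫⁻ ω, R n ω * ENNReal.ofReal (1 - l (n + 1) ω) * φ₁ (e (n + 1) ω) ∂Q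
            + ∫⁻ ω, R n ω * ENNReal.ofReal (l (n + 1) ω) * φ₂ (e (n + 1) ω) ∂Q := by
            simp_rw [hsucc]
            exact lintegral_add_left ((hm1.mono (F.le n) le_rfl).mul (hφ₁.comp hen)) _
        _ ≤ ∫⁻ ω, R n ω * ENNReal.ofReal (1 - l (n + 1) ω) ∂Q
            + ∫⁻ ω, R n ω * ENNReal.ofReal (l (n + 1) ω) ∂Q :=
            add_le_add (hprod _ _ hm1 hφ₁ hd1) (hprod _ _ hm2 hφ₂ hd2)
        _ = ∫⁻ ω, R n ω ∂Q := by
            rw [← lintegral_add_left (hm1.mono (F.le n) le_rfl)]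
            refine lintegral_congr fun ω => ?_
            rw [← mul_add, ← ENNReal.ofReal_add (by linarith [(hbet.1 (n + 1) ω).2])
              (hbet.1 (n + 1) ω).1]
            simp
        _ ≤ 1 := ih
  refine le_of_eq_of_le (lintegral_congr_ae ?_) (hRle k)
  have hpos' : ∀ᵐ ω ∂Q, ∀ i, 1 ≤ i → 0 < mix lstar (E₁ i ω) (E₂ i ω) :=
    ae_all_iff.2 fun i => eventually_imp_distrib_left.2 fun hi =>
      hiid.ae_of_ae_one (p := fun x => 0 < mix lstar x.1 x.2) (hm measurableSet_Ioi) hpos hi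
  have hnn' : ∀ᵐ ω ∂Q, ∀ i, 1 ≤ i → 0 ≤ E₁ i ω ∧ 0 ≤ E₂ i ω :=
    ae_all_iff.2 fun i => eventually_imp_distrib_left.2 fun hi => hiid.nonneg i hi
  filter_upwards [hpos', hnn'] with ω h1 h2
  simp only [wealth, R]
  rw [← Finset.prod_div_distrib, ENNReal.ofReal_prod_of_nonneg]
  · refine Finset.prod_congr rfl fun i hi => ?_
    obtain ⟨hi, -⟩ := Finset.mem_Icc.1 hi
    have ha := div_nonneg (h2 i hi).1 (h1 i hi).le
    have hb := div_nonneg (h2 i hi).2 (h1 i hi).le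
    have hl0 := (hbet.1 i ω).1
    have hl1 := sub_nonneg.2 (hbet.1 i ω).2
    simp only [φ₁, φ₂, e]
    rw [← ENNReal.ofReal_mul hl1, ← ENNReal.ofReal_mul hl0,
      ← ENNReal.ofReal_add (mul_nonneg hl1 ha) (mul_nonneg hl0 hb)]
    congr 1
    simp only [mix]
    ring
  · intro i hi
    obtain ⟨hi, -⟩ := Finset.mem_Icc.1 hi
    exact div_nonneg (mix_nonneg (hbet.1 i ω) (h2 i hi).1 (h2 i hi).2) (h1 i hi).le

end Portfolio

/-! ### Uniform Borel-Cantelli arguments -/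

/-- A supremum can equal ε without any term reaching it; at level ε/2 some term does. The events
decrease in m, so a single m suffices. -/
lemma unifEventuallySmall_of_forall_exists {𝒬 : Set (Measure Ω)} {Z : Measure Ω → ℕ → Ω → EReal}
    (h : ∀ ε : ℝ, 0 < ε → ∀ η : ℝ≥0∞, 0 < η → ∃ m : ℕ, ∀ Q ∈ 𝒬,
      Q {ω | ∃ k, m ≤ k ∧ (ε : EReal) ≤ Z Q k ω} ≤ η) :
    UnifEventuallySmall 𝒬 Z := by
  intro ε hε
  rw [ENNReal.tendsto_atTop_zero]
  intro η hη
  obtain ⟨m, hm⟩ := h (ε / 2) (half_pos hε) η hη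
  refine ⟨m, fun n hn => iSup₂_le fun Q hQ => (measure_mono fun ω hω => ?_).trans (hm Q hQ)⟩
  have h1 : ((ε / 2 : ℝ) : EReal) < ⨆ k : ℕ, ⨆ _ : n ≤ k, Z Q k ω :=
    lt_of_lt_of_le (EReal.coe_lt_coe_iff.2 (half_lt_self hε)) hω
  simp only [lt_iSup_iff] at h1
  obtain ⟨k, hk, h2⟩ := h1
  exact ⟨k, hn.trans hk, h2.le⟩

/-- A uniform Borel-Cantelli lemma. -/
lemma exists_forall_measure_exists_le {b : ℕ → ℝ≥0∞} (hb : ∑' k, b k ≠ ⊤) {η : ℝ≥0∞}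
    (hη : 0 < η) : ∃ m₀ : ℕ, ∀ m, m₀ ≤ m → ∀ (Q : Measure Ω) (s : ℕ → Set Ω),
      (∀ k, m ≤ k → Q (s k) ≤ b k) → Q {ω | ∃ k, m ≤ k ∧ ω ∈ s k} ≤ η := by
  obtain ⟨m₀, hm₀⟩ := (ENNReal.tendsto_atTop_zero.1 (ENNReal.tendsto_sum_nat_add b hb)) η hη
  refine ⟨m₀, fun m hm Q s hs => ?_⟩
  have hsub : {ω | ∃ k, m ≤ k ∧ ω ∈ s k} ⊆ ⋃ k, s (k + m) := by
    rintro ω ⟨k, hk, hω⟩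
    obtain ⟨j, rfl⟩ := Nat.exists_eq_add_of_le' hk
    exact Set.mem_iUnion.2 ⟨j, hω⟩
  calc Q {ω | ∃ k, m ≤ k ∧ ω ∈ s k} ≤ Q (⋃ k, s (k + m)) := measure_mono hsub
    _ ≤ ∑' k, Q (s (k + m)) := measure_iUnion_le _
    _ ≤ ∑' k, b (k + m) := ENNReal.tsum_le_tsum fun k => hs _ (Nat.le_add_left m k)
    _ ≤ η := hm₀ m hm

/-- The exponential is dominated by the power -4 of k^s, and s ≥ 1/2 makes the resulting exponent at
most -2. The uses are s = 1 and s = 1/p with p < 2. -/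
lemma summable_exp_neg_rpow_mul {s c : ℝ} (hs : 1 / 2 ≤ s) (hc : 0 < c) :
    Summable fun k : ℕ => Real.exp (-(c * (k : ℝ) ^ s)) := by
  have h1 : Tendsto (fun k : ℕ => (k : ℝ) ^ s) atTop atTop :=
    (tendsto_rpow_atTop (by linarith)).comp tendsto_natCast_atTop_atTop
  have h2 := (isLittleO_exp_neg_mul_rpow_atTop hc (-4)).comp_tendsto h1
  refine summable_of_isBigO_nat (g := fun k : ℕ => (k : ℝ) ^ (s * (-4)))
    (Real.summable_nat_rpow.2 (by linarith)) ?_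
  refine IsBigO.congr h2.isBigO (fun k => ?_) (fun k => ?_)
  · simp [Function.comp]
  · simp only [Function.comp]
    rw [← Real.rpow_mul k.cast_nonneg]

/-! ### Consequences of the regret bound: claims (i) and (ii) -/

section Regret

variable {F : Filtration ℕ mΩ} {E₁ E₂ : ℕ → Ω → ℝ} {𝒬 : Set (Measure Ω)}

lemma ae_forall_mix_pos {Q : Measure Ω}
    (hE : ∀ n, 1 ≤ n → Measurable[F n] (E₁ n) ∧ Measurable[F n] (E₂ n))
    (hiid : IsIIDNonneg F E₁ E₂ Q) (hbot : ⊥ < ellStar E₁ E₂ Q)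
    (htop : ellStar E₁ E₂ Q < ⊤) {l : ℝ} (hl : IsLogOptimalPortfolio E₁ E₂ Q l) :
    ∀ᵐ ω ∂Q, ∀ i, 1 ≤ i → 0 < mix l (E₁ i ω) (E₂ i ω) := by
  have hm : Measurable fun x : ℝ × ℝ => mix l x.1 x.2 := by unfold mix; fun_prop
  have h1 := (hl.pos_and_integrable ((hE 1 le_rfl).1.mono (F.le 1) le_rfl)
    ((hE 1 le_rfl).2.mono (F.le 1) le_rfl) hbot htop).1
  exact ae_all_iff.2 fun i => eventually_imp_distrib_left.2 fun hi =>
    hiid.ae_of_ae_one (p := fun x => 0 < mix l x.1 x.2) (hm measurableSet_Ioi) h1 hi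

lemma wealth_const_pos {Ω : Type*} {E₁ E₂ : ℕ → Ω → ℝ} {l : ℝ} {ω : Ω} (h : ∀ i, 1 ≤ i → 0 < mix l (E₁ i ω) (E₂ i ω)) (k : ℕ) :
    0 < wealth E₁ E₂ (fun _ _ => l) k ω :=
  Finset.prod_pos fun i hi => h i (Finset.mem_Icc.1 hi).1

lemma log_wealth_const {Ω : Type*} {E₁ E₂ : ℕ → Ω → ℝ} {l : ℝ} {ω : Ω} (h : ∀ i, 1 ≤ i → 0 < mix l (E₁ i ω) (E₂ i ω)) (k : ℕ) :
    Real.log (wealth E₁ E₂ (fun _ _ => l) k ω) =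
      ∑ i ∈ Finset.Icc 1 k, Real.log (mix l (E₁ i ω) (E₂ i ω)) :=
  Real.log_prod fun i hi => (h i (Finset.mem_Icc.1 hi).1).ne'

/-- The portfolio `l` is one competitor in the supremum. Positivity of `w` is forced, since
otherwise subtracting log w = -∞ would make the regret infinite. -/
lemma log_wealth_sub_le_of_regret_le {Ω : Type*} {E₁ E₂ : ℕ → Ω → ℝ} {l : ℝ}
    (hl : l ∈ Set.Icc (0 : ℝ) 1) {ω : Ω}
    (h : ∀ i, 1 ≤ i → 0 < mix l (E₁ i ω) (E₂ i ω)) {k : ℕ} {w r : ℝ}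
    (hr : regret (fun i => E₁ i ω) (fun i => E₂ i ω) w k ≤ (r : EReal)) :
    0 < w ∧ Real.log (wealth E₁ E₂ (fun _ _ => l) k ω) - r ≤ Real.log w := by
  have h1 : ((Real.log (wealth E₁ E₂ (fun _ _ => l) k ω) : ℝ) : EReal) ≤
      ⨆ l ∈ Set.Icc (0 : ℝ) 1, ∑ i ∈ Finset.Icc 1 k, elog (mix l (E₁ i ω) (E₂ i ω)) := by
    refine le_trans (le_of_eq ?_) (le_iSup₂ (f := fun l (_ : l ∈ Set.Icc (0 : ℝ) 1) =>
      ∑ i ∈ Finset.Icc 1 k, elog (mix l (E₁ i ω) (E₂ i ω))) l hl)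
    rw [log_wealth_const h]
    refine (map_sum (⟨⟨(↑), EReal.coe_zero⟩, EReal.coe_add⟩ : ℝ →+ EReal) _ _).trans ?_
    exact Finset.sum_congr rfl fun i hi => (elog_of_pos (h i (Finset.mem_Icc.1 hi).1)).symm
  have h2 := (EReal.sub_le_sub h1 (le_refl (elog w))).trans hr
  rcases le_or_gt w 0 with hw | hw
  · rw [elog_of_nonpos hw, EReal.coe_sub_bot] at h2
    exact absurd h2 (not_le.2 (EReal.coe_lt_top r))
  · rw [elog_of_pos hw, ← EReal.coe_sub, EReal.coe_le_coe_iff] at h2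
    exact ⟨hw, by linarith⟩

section Bounds

variable (hE : ∀ n, 1 ≤ n → Measurable[F n] (E₁ n) ∧ Measurable[F n] (E₂ n))
  (h𝒬 : ∀ Q ∈ 𝒬, IsProbabilityMeasure Q ∧ IsIIDNonneg F E₁ E₂ Q ∧
      ⊥ < ellStar E₁ E₂ Q ∧ ellStar E₁ E₂ Q < ⊤)
include hE h𝒬

/-- The wealth of a process in the class rarely exceeds that of the log-optimal portfolio by a large
factor. -/
lemma measure_exp_mul_wealth_le {W' : ℕ → Ω → ℝ} (hW' : W' ∈ eProcessClass F E₁ E₂ 𝒬)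
    {Q : Measure Ω} (hQ : Q ∈ 𝒬) {l : ℝ} (hl : IsLogOptimalPortfolio E₁ E₂ Q l) {k : ℕ}
    (hk : 1 ≤ k) (c : ℝ) :
    Q {ω | Real.exp c * wealth E₁ E₂ (fun _ _ => l) k ω ≤ W' k ω} ≤
      ENNReal.ofReal (Real.exp (-c)) := by
  obtain ⟨-, -, b, hb, -, hWb⟩ := hW'
  obtain ⟨hP, hiid, hbot, htop⟩ := h𝒬 Q hQ
  have hwm : ∀ l : ℕ → Ω → ℝ, IsBettingStrategy F l → Measurable (wealth E₁ E₂ l k) := by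
    intro l hl
    refine Finset.measurable_prod _ fun i hi => ?_
    obtain ⟨j, rfl⟩ := Nat.exists_eq_add_of_le' (Finset.mem_Icc.1 hi).1
    have h1 := (hE (j + 1) (by omega)).1.mono (F.le _) le_rfl
    have h2 := (hE (j + 1) (by omega)).2.mono (F.le _) le_rfl
    have h3 := (hl.2 j).mono (F.le _) le_rfl
    unfold mix
    fun_prop
  have hmeas : Measurable fun ω =>
      ENNReal.ofReal (wealth E₁ E₂ b k ω / wealth E₁ E₂ (fun _ _ => l) k ω) :=
    ((hwm b hb).div (hwm _ ⟨fun _ _ => hl.1, fun _ => measurable_const⟩)).ennreal_ofReal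
  calc Q {ω | Real.exp c * wealth E₁ E₂ (fun _ _ => l) k ω ≤ W' k ω}
      ≤ Q {ω | ENNReal.ofReal (Real.exp c) ≤
          ENNReal.ofReal (wealth E₁ E₂ b k ω / wealth E₁ E₂ (fun _ _ => l) k ω)} := by
        refine measure_mono_ae ?_
        filter_upwards [ae_forall_mix_pos hE hiid hbot htop hl, hWb Q (Or.inr hQ) k hk]
          with ω h1 h2 h3
        refine ENNReal.ofReal_le_ofReal ?_
        rw [le_div_iff₀ (wealth_const_pos h1 k)]
        exact le_trans h3 h2
    _ ≤ (∫⁻ ω, ENNReal.ofReal (wealth E₁ E₂ b k ω / wealth E₁ E₂ (fun _ _ => l) k ω) ∂Q) /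
          ENNReal.ofReal (Real.exp c) :=
        meas_ge_le_lintegral_div hmeas.aemeasurable (by simp [Real.exp_pos])
          ENNReal.ofReal_ne_top
    _ ≤ 1 / ENNReal.ofReal (Real.exp c) := by
        gcongr
        exact lintegral_wealth_div_wealth_le_one hE hiid hbot htop hl hb k
    _ = ENNReal.ofReal (Real.exp (-c)) := by
        rw [one_div, ← ENNReal.ofReal_inv_of_pos (Real.exp_pos c), Real.exp_neg]

lemma exists_measure_exp_mul_wealth_le {W' : ℕ → Ω → ℝ} (hW' : W' ∈ eProcessClass F E₁ E₂ 𝒬)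
    {c : ℕ → ℝ} (hc : Summable fun k => Real.exp (-c k)) {η : ℝ≥0∞} (hη : 0 < η) :
    ∃ m₀ : ℕ, ∀ m, m₀ ≤ m → ∀ Q ∈ 𝒬, ∀ l, IsLogOptimalPortfolio E₁ E₂ Q l →
      Q {ω | ∃ k, m ≤ k ∧ Real.exp (c k) * wealth E₁ E₂ (fun _ _ => l) k ω ≤ W' k ω} ≤ η := by
  obtain ⟨m₀, h⟩ := exists_forall_measure_exists_le (Ω := Ω)
    (b := fun k => ENNReal.ofReal (Real.exp (-c k))) hc.tsum_ofReal_ne_top hη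
  refine ⟨max m₀ 1, fun m hm Q hQ l hl => h m (le_of_max_le_left hm) Q
    (fun k => {ω | Real.exp (c k) * wealth E₁ E₂ (fun _ _ => l) k ω ≤ W' k ω}) fun k hk => ?_⟩
  exact measure_exp_mul_wealth_le hE h𝒬 hW' hQ hl ((le_of_max_le_right hm).trans hk) _

variable {W : ℕ → Ω → ℝ} {r : ℕ → ℝ}
  (hreg : ∀ Q ∈ 𝒬, ∀ n, 1 ≤ n → ∀ᵐ ω ∂Q,
      regret (fun i => E₁ i ω) (fun i => E₂ i ω) (W n ω) n ≤ (r n : EReal))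
include hreg

lemma ae_forall_log_wealth_sub_le {Q : Measure Ω} (hQ : Q ∈ 𝒬) {l : ℝ}
    (hl : IsLogOptimalPortfolio E₁ E₂ Q l) :
    ∀ᵐ ω ∂Q, ∀ k, 1 ≤ k → 0 < wealth E₁ E₂ (fun _ _ => l) k ω ∧ 0 < W k ω ∧
      Real.log (wealth E₁ E₂ (fun _ _ => l) k ω) - r k ≤ Real.log (W k ω) := by
  obtain ⟨-, hiid, hbot, htop⟩ := h𝒬 Q hQ
  filter_upwards [ae_forall_mix_pos hE hiid hbot htop hl,
    ae_all_iff.2 fun n => eventually_imp_distrib_left.2 (hreg Q hQ n)] with ω h1 h2 k hk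
  exact ⟨wealth_const_pos h1 k, log_wealth_sub_le_of_regret_le hl.1 h1 (h2 k hk)⟩

theorem isUnifLogOptimal_of_regret_le (hr : r =o[atTop] (fun n : ℕ => (n : ℝ))) :
    IsUnifLogOptimal 𝒬 (eProcessClass F E₁ E₂ 𝒬) W := by
  intro W' hW'
  refine unifEventuallySmall_of_forall_exists fun ε hε η hη => ?_
  -- The tolerance is split: W' exceeds V by a factor exp(εk/2) only rarely, and the regret
  -- eventually costs at most εk/4, which together stay below εk.
  have hsum : Summable fun k : ℕ => Real.exp (-(ε / 2 * k)) := by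
    simpa using summable_exp_neg_rpow_mul (s := 1) (by norm_num) (half_pos hε)
  obtain ⟨m₀, hm₀⟩ := exists_measure_exp_mul_wealth_le hE h𝒬 hW' hsum hη
  obtain ⟨m₁, hm₁⟩ := eventually_atTop.1 (hr.bound (show 0 < ε / 4 by positivity))
  refine ⟨max m₀ (max m₁ 1), fun Q hQ => ?_⟩
  obtain ⟨hP, hiid, hbot, htop⟩ := h𝒬 Q hQ
  obtain ⟨l, hl⟩ := exists_isLogOptimalPortfolio ((hE 1 le_rfl).1.mono (F.le 1) le_rfl)
    ((hE 1 le_rfl).2.mono (F.le 1) le_rfl) (hiid.nonneg 1 le_rfl) hbot htop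
  refine le_trans (measure_mono_ae ?_) (hm₀ (max m₀ (max m₁ 1)) (le_max_left _ _) Q hQ l hl)
  filter_upwards [ae_forall_log_wealth_sub_le hE h𝒬 hreg hQ hl] with ω h1 h2
  obtain ⟨k, hk, h3⟩ := h2
  refine ⟨k, hk, ?_⟩
  simp only [max_le_iff] at hk
  obtain ⟨hk₀, hk₁, hk2⟩ := hk
  obtain ⟨hV, hWpos, hlog⟩ := h1 k hk2
  have hk0 : (0 : ℝ) < k := by exact_mod_cast hk2
  by_contra! h4
  have h5 : elog (W' k ω) ≤
      ((ε / 2 * k + Real.log (wealth E₁ E₂ (fun _ _ => l) k ω) : ℝ) : EReal) := by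
    rcases le_or_gt (W' k ω) 0 with hw | hw
    · rw [elog_of_nonpos hw]; exact bot_le
    · rw [elog_of_pos hw, EReal.coe_le_coe_iff, ← Real.log_exp (ε / 2 * k),
        ← Real.log_mul (Real.exp_pos _).ne' hV.ne']
      exact Real.log_le_log hw h4.le
  have h6 : (((k : ℝ)⁻¹ : ℝ) : EReal) * (elog (W' k ω) - elog (W k ω)) ≤
      (((k : ℝ)⁻¹ * (ε / 2 * k + Real.log (wealth E₁ E₂ (fun _ _ => l) k ω)
        - Real.log (W k ω)) : ℝ) : EReal) := by
    rw [elog_of_pos hWpos, EReal.coe_mul]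
    refine mul_le_mul_of_nonneg_left ?_ (EReal.coe_nonneg.2 (by positivity))
    rw [EReal.coe_sub]
    exact EReal.sub_le_sub h5 le_rfl
  have h7 := EReal.coe_le_coe_iff.1 (h3.trans h6)
  have h8 := (le_abs_self _).trans (hm₁ k hk₁)
  rw [Real.norm_of_nonneg hk0.le] at h8
  rw [inv_mul_eq_div, le_div_iff₀ hk0] at h7
  nlinarith [mul_pos hε hk0]

/-- The regret bounds log W from below; membership of W in the class bounds it from above. The
positivity facts are kept inside the event so that the extended logarithms can later be replaced by
real ones. -/
theorem exists_measure_not_abs_log_sub_lt (hW : W ∈ eProcessClass F E₁ E₂ 𝒬) {a : ℕ → ℝ}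
    (ha : ∀ ε : ℝ, 0 < ε → Summable (fun k : ℕ => Real.exp (-(a k * ε / 2))))
    (har : Tendsto (fun n => (a n)⁻¹ * r n) atTop (𝓝 0)) {ε : ℝ} (hε : 0 < ε) {η : ℝ≥0∞}
    (hη : 0 < η) :
    ∃ m₀ : ℕ, ∀ m, m₀ ≤ m → ∀ Q ∈ 𝒬, ∀ l, IsLogOptimalPortfolio E₁ E₂ Q l →
      Q {ω | ∃ k, m ≤ k ∧ ¬ (0 < W k ω ∧ 0 < wealth E₁ E₂ (fun _ _ => l) k ω ∧ 0 < a k ∧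
        |Real.log (W k ω) - Real.log (wealth E₁ E₂ (fun _ _ => l) k ω)| < ε * a k)} ≤ η := by
  obtain ⟨m₀, hm₀⟩ := exists_measure_exp_mul_wealth_le hE h𝒬 hW (ha ε hε) hη
  -- Positivity of `a k` for large k is not assumed: summable exponentials tend to 0, hence drop
  -- below 1.
  obtain ⟨m₁, hm₁⟩ := eventually_atTop.1
    ((ha 1 one_pos).tendsto_atTop_zero.eventually (gt_mem_nhds one_pos))
  obtain ⟨m₂, hm₂⟩ := eventually_atTop.1 (har.eventually (gt_mem_nhds hε))
  refine ⟨max m₀ (max m₁ (max m₂ 1)), fun m hm Q hQ l hl => ?_⟩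
  simp only [max_le_iff] at hm
  refine le_trans (measure_mono_ae ?_) (hm₀ m hm.1 Q hQ l hl)
  filter_upwards [ae_forall_log_wealth_sub_le hE h𝒬 hreg hQ hl] with ω h1 h2
  obtain ⟨k, hk, h3⟩ := h2
  refine ⟨k, hk, ?_⟩
  obtain ⟨hV, hWpos, hlog⟩ := h1 k (hm.2.2.2.trans hk)
  have hak : 0 < a k := by
    have := hm₁ k (hm.2.1.trans hk)
    rw [Real.exp_lt_one_iff] at this
    linarith
  have hrk := hm₂ k (hm.2.2.1.trans hk)
  rw [inv_mul_eq_div, div_lt_iff₀ hak] at hrk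
  by_contra! h4
  refine h3 ⟨hWpos, hV, hak, abs_lt.2 ⟨by linarith, ?_⟩⟩
  have h5 := Real.log_lt_log hWpos h4
  rw [Real.log_mul (Real.exp_pos _).ne' hV.ne', Real.log_exp] at h5
  nlinarith [mul_pos hε hak]

theorem isUnifAsympEquiv_of_regret_le (hW : W ∈ eProcessClass F E₁ E₂ 𝒬) {a : ℕ → ℝ}
    (ha : ∀ ε : ℝ, 0 < ε → Summable (fun k : ℕ => Real.exp (-(a k * ε / 2))))
    (har : Tendsto (fun n => (a n)⁻¹ * r n) atTop (𝓝 0)) {lstar : Measure Ω → ℝ}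
    (hl : ∀ Q ∈ 𝒬, IsLogOptimalPortfolio E₁ E₂ Q (lstar Q)) :
    IsUnifAsympEquiv 𝒬 W (fun Q => wealth E₁ E₂ (fun _ _ => lstar Q)) a := by
  refine unifEventuallySmall_of_forall_exists fun ε hε η hη => ?_
  obtain ⟨m, hm⟩ := exists_measure_not_abs_log_sub_lt hE h𝒬 hreg hW ha har hε hη
  refine ⟨m, fun Q hQ => (measure_mono ?_).trans (hm m le_rfl Q hQ _ (hl Q hQ))⟩
  rintro ω ⟨k, hk, h⟩
  refine ⟨k, hk, fun ⟨h1, h2, h3, h4⟩ => ?_⟩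
  rw [elog_of_pos h1, elog_of_pos h2, ← EReal.coe_sub, EReal.coe_abs, ← EReal.coe_mul,
    EReal.coe_le_coe_iff, inv_mul_eq_div, le_div_iff₀ h3] at h
  linarith

end Bounds

end Regret

/-! ### Maximal inequalities for sums of independent variables -/

section Kolmogorov

variable {F : Filtration ℕ mΩ} {Q : Measure Ω} [IsProbabilityMeasure Q] {Y : ℕ → Ω → ℝ} {C : ℝ}

/-- Kolmogorov's maximal inequality. -/
theorem measure_exists_le_abs_sum (hY : ∀ n, 1 ≤ n → Measurable[F n] (Y n))
    (hind : ∀ n, Indep (MeasurableSpace.comap (Y (n + 1)) inferInstance) (F n) Q)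
    (hC : ∀ n ω, |Y n ω| ≤ C) (h0 : ∀ n, 1 ≤ n → ∫ ω, Y n ω ∂Q = 0) (n : ℕ) {c : ℝ} (hc : 0 < c) :
    Q {ω | ∃ k, k ≤ n ∧ c ≤ |∑ i ∈ Finset.Icc 1 k, Y i ω|} ≤
      ENNReal.ofReal ((∑ i ∈ Finset.Icc 1 n, ∫ ω, Y i ω ^ 2 ∂Q) / c ^ 2) := by
  let S : ℕ → Ω → ℝ := fun n ω => ∑ i ∈ Finset.Icc 1 n, Y i ω
  have hSm : ∀ n, Measurable[F n] (S n) := fun n => Finset.measurable_sum _ fun i hi =>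
    (hY i (Finset.mem_Icc.1 hi).1).mono (F.mono (Finset.mem_Icc.1 hi).2) le_rfl
  have hSm' : ∀ n, Measurable (S n) := fun n => (hSm n).mono (F.le n) le_rfl
  have hYm' : ∀ n, Measurable (Y (n + 1)) := fun n => (hY _ (by omega)).mono (F.le _) le_rfl
  have hSC : ∀ n ω, |S n ω| ≤ n * C := fun n ω => by
    refine (Finset.abs_sum_le_sum_abs _ _).trans ((Finset.sum_le_card_nsmul _ _ C
      fun i _ => hC i ω).trans ?_)
    simp
  have hC0 : ∀ ω : Ω, 0 ≤ C := fun ω => (abs_nonneg _).trans (hC 0 ω)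
  have hS2 : ∀ n, Integrable (fun ω => S n ω ^ 2) Q := fun n =>
    Integrable.of_bound ((hSm' n).pow_const 2).aestronglyMeasurable ((n * C) ^ 2)
      (ae_of_all _ fun ω => by
        rw [Real.norm_of_nonneg (sq_nonneg _), ← sq_abs]
        exact pow_le_pow_left₀ (abs_nonneg _) (hSC n ω) 2)
  have hY2 : ∀ n, Integrable (fun ω => Y (n + 1) ω ^ 2) Q := fun n =>
    Integrable.of_bound ((hYm' n).pow_const 2).aestronglyMeasurable (C ^ 2)
      (ae_of_all _ fun ω => by
        rw [Real.norm_of_nonneg (sq_nonneg _), ← sq_abs]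
        exact pow_le_pow_left₀ (abs_nonneg _) (hC _ ω) 2)
  have hSY : ∀ n, Integrable (fun ω => S n ω * Y (n + 1) ω) Q := fun n =>
    Integrable.of_bound ((hSm' n).mul (hYm' n)).aestronglyMeasurable (n * C * C)
      (ae_of_all _ fun ω => by
        rw [Real.norm_eq_abs, abs_mul]
        exact mul_le_mul (hSC n ω) (hC _ ω) (abs_nonneg _)
          (mul_nonneg n.cast_nonneg (hC0 ω)))
  have hsucc : ∀ n ω, S (n + 1) ω = S n ω + Y (n + 1) ω := fun n ω =>
    Finset.sum_Icc_succ_top (by omega) _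
  -- The past sum restricted to a past event is independent of the next term, which has mean zero.
  -- So the cross terms vanish, squared sums form a submartingale and the variances add.
  have hcross : ∀ n (s : Set Ω), MeasurableSet[F n] s →
      ∫ ω in s, S n ω * Y (n + 1) ω ∂Q = 0 := by
    intro n s hs
    have hm : Measurable[F n] (s.indicator (S n)) := (hSm n).indicator hs
    have hI : IndepFun (s.indicator (S n)) (Y (n + 1)) Q :=
      (IndepFun_iff_Indep _ _ _).2 (indep_of_indep_of_le_left (hind n).symm hm.comap_le)
    rw [← integral_indicator (F.le n s hs)]
    have : s.indicator (fun ω => S n ω * Y (n + 1) ω) = s.indicator (S n) * Y (n + 1) := by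
      ext ω
      by_cases h : ω ∈ s <;> simp [h]
    rw [this, hI.integral_mul_eq_mul_integral (hm.mono (F.le n) le_rfl).aestronglyMeasurable
      (hYm' n).aestronglyMeasurable, h0 _ (by omega), mul_zero]
  have hset : ∀ n (s : Set Ω), MeasurableSet[F n] s →
      ∫ ω in s, S (n + 1) ω ^ 2 ∂Q = ∫ ω in s, S n ω ^ 2 ∂Q + ∫ ω in s, Y (n + 1) ω ^ 2 ∂Q := by
    intro n s hs
    have h1 : ∀ ω, S (n + 1) ω ^ 2 = S n ω ^ 2 + 2 * (S n ω * Y (n + 1) ω) + Y (n + 1) ω ^ 2 :=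
      fun ω => by rw [hsucc]; ring
    have h2 : Integrable (fun ω => S n ω ^ 2 + 2 * (S n ω * Y (n + 1) ω)) Q :=
      (hS2 n).add ((hSY n).const_mul 2)
    simp_rw [h1]
    rw [integral_add h2.integrableOn (hY2 n).integrableOn,
      integral_add (hS2 n).integrableOn ((hSY n).const_mul 2).integrableOn,
      integral_const_mul, hcross n s hs]
    ring
  have hsub : Submartingale (fun n ω => S n ω ^ 2) F Q :=
    submartingale_of_setIntegral_le_succ (fun n => ((hSm n).pow_const 2).stronglyMeasurable) hS2
      fun n s hs => by
        rw [hset n s hs]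
        exact le_add_of_nonneg_right (integral_nonneg fun ω => sq_nonneg _)
  have hvar : ∀ n, ∫ ω, S n ω ^ 2 ∂Q = ∑ i ∈ Finset.Icc 1 n, ∫ ω, Y i ω ^ 2 ∂Q := by
    intro n
    induction n with
    | zero => simp [S]
    | succ n ih =>
      have := hset n Set.univ MeasurableSet.univ
      simp only [setIntegral_univ] at this
      rw [this, ih, Finset.sum_Icc_succ_top (by omega)]
  have hc2 : 0 < c ^ 2 := by positivity
  have hmax := maximal_ineq hsub (fun n ω => sq_nonneg (S n ω)) (ε := ⟨c ^ 2, hc2.le⟩) n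
  rw [ENNReal.ofReal_div_of_pos hc2, ENNReal.le_div_iff_mul_le (Or.inl (by simpa using hc.ne'))
    (Or.inl ENNReal.ofReal_ne_top), mul_comm]
  refine le_trans ?_ (hmax.trans (ENNReal.ofReal_le_ofReal
    ((setIntegral_le_integral (hS2 n) (ae_of_all _ fun ω => sq_nonneg _)).trans (hvar n).le)))
  rw [ENNReal.ofReal_eq_coe_nnreal hc2.le]
  refine mul_le_mul_right (measure_mono ?_) _
  rintro ω ⟨k, hk, hck⟩
  refine Finset.le_sup'_of_le (fun k => S k ω ^ 2) (Finset.mem_range.2 (Nat.lt_succ_of_le hk)) ?_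
  change c ^ 2 ≤ S k ω ^ 2
  rw [← sq_abs (S k ω)]
  exact pow_le_pow_left₀ hc.le hck 2

variable {X : ℕ → Ω → ℝ}

/-- A maximal inequality for sums of i.i.d. variables, by truncation to a bounded set `B`. -/
theorem measure_exists_le_abs_sum_of_truncation (hX : ∀ n, 1 ≤ n → Measurable[F n] (X n))
    (hid : ∀ n, 1 ≤ n → IdentDistrib (X n) (X 1) Q Q)
    (hind : ∀ n, Indep (MeasurableSpace.comap (X (n + 1)) inferInstance) (F n) Q)
    {B : Set ℝ} (hB : MeasurableSet B) {A : ℝ} (hA0 : 0 ≤ A) (hBA : ∀ x ∈ B, |x| ≤ A) (n : ℕ)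
    {c : ℝ} (hc : 0 < c) (hmean : n * |∫ ω, B.indicator id (X 1 ω) ∂Q| ≤ c / 2) :
    Q {ω | ∃ k, k ≤ n ∧ c ≤ |∑ i ∈ Finset.Icc 1 k, X i ω|} ≤
      n * Q {ω | X 1 ω ∉ B} +
        ENNReal.ofReal (4 * n / c ^ 2) * ∫⁻ ω, ENNReal.ofReal (B.indicator id (X 1 ω) ^ 2) ∂Q := by
  set τ : ℝ → ℝ := B.indicator id with hτ
  have hτm : Measurable τ := measurable_id.indicator hB
  have hτA : ∀ x, |τ x| ≤ A := fun x => by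
    by_cases h : x ∈ B
    · simpa [hτ, h] using hBA x h
    · simpa [hτ, h] using hA0
  set μ := ∫ ω, τ (X 1 ω) ∂Q with hμ
  have hX' : ∀ n, 1 ≤ n → Measurable (X n) := fun n hn => (hX n hn).mono (F.le n) le_rfl
  let Y : ℕ → Ω → ℝ := fun i ω => τ (X i ω) - μ
  have hint : Integrable (fun ω => τ (X 1 ω)) Q :=
    Integrable.of_bound (hτm.comp (hX' 1 le_rfl)).aestronglyMeasurable A
      (ae_of_all _ fun ω => hτA _)
  have hint2 : Integrable (fun ω => τ (X 1 ω) ^ 2) Q :=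
    Integrable.of_bound ((hτm.comp (hX' 1 le_rfl)).pow_const 2).aestronglyMeasurable (A ^ 2)
      (ae_of_all _ fun ω => by
        rw [Real.norm_of_nonneg (sq_nonneg _), ← sq_abs]
        exact pow_le_pow_left₀ (abs_nonneg _) (hτA _) 2)
  have hYint : ∀ (φ : ℝ → ℝ), Measurable φ → ∀ i, 1 ≤ i →
      ∫ ω, φ (X i ω) ∂Q = ∫ ω, φ (X 1 ω) ∂Q :=
    fun φ hφ i hi => ((hid i hi).comp hφ).integral_eq
  have hK := measure_exists_le_abs_sum (F := F) (Q := Q) (Y := Y) (C := A + |μ|)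
    (fun n hn => (hτm.comp (hX n hn)).sub_const μ)
    (fun n => indep_of_indep_of_le_left (hind n) (by
      have : Measurable[MeasurableSpace.comap (X (n + 1)) inferInstance] (Y (n + 1)) :=
        (hτm.comp (comap_measurable _)).sub_const μ
      exact this.comap_le))
    (fun i ω => (abs_sub _ _).trans (add_le_add_left (hτA _) _))
    (fun i hi => by
      rw [hYint (fun x => τ x - μ) (hτm.sub_const μ) i hi, integral_sub hint (integrable_const _)]
      simp [hμ])
    n (half_pos hc)
  have hvar : ∀ i ∈ Finset.Icc 1 n, ∫ ω, Y i ω ^ 2 ∂Q ≤ ∫ ω, τ (X 1 ω) ^ 2 ∂Q := by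
    intro i hi
    rw [hYint (fun x => (τ x - μ) ^ 2) ((hτm.sub_const μ).pow_const 2) i (Finset.mem_Icc.1 hi).1]
    have h1 : ∀ ω, (τ (X 1 ω) - μ) ^ 2 = τ (X 1 ω) ^ 2 - 2 * μ * τ (X 1 ω) + μ ^ 2 :=
      fun ω => by ring
    simp_rw [h1]
    rw [integral_add (f := fun ω => τ (X 1 ω) ^ 2 - 2 * μ * τ (X 1 ω))
      (hint2.sub (hint.const_mul _)) (integrable_const _),
      integral_sub hint2 (hint.const_mul _), integral_const_mul, ← hμ]
    simp only [integral_const, probReal_univ, one_smul]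
    nlinarith [sq_nonneg μ]
  -- Either some term leaves `B`, or all terms agree with their truncations. In the latter case
  -- recentering costs at most c/2, so the centered sum reaches c/2; hence the factor 4 in the
  -- variance term.
  have hsub : {ω | ∃ k, k ≤ n ∧ c ≤ |∑ i ∈ Finset.Icc 1 k, X i ω|} ⊆
      (⋃ i ∈ Finset.Icc 1 n, {ω | X i ω ∉ B}) ∪
        {ω | ∃ k, k ≤ n ∧ c / 2 ≤ |∑ i ∈ Finset.Icc 1 k, Y i ω|} := by
    rintro ω ⟨k, hk, hck⟩
    by_cases h : ∀ i ∈ Finset.Icc 1 n, X i ω ∈ B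
    · refine Or.inr ⟨k, hk, ?_⟩
      have h1 : ∑ i ∈ Finset.Icc 1 k, X i ω = ∑ i ∈ Finset.Icc 1 k, Y i ω + k * μ := by
        simp only [Y]
        rw [Finset.sum_sub_distrib]
        simp only [Finset.sum_const, Nat.card_Icc, add_tsub_cancel_right, nsmul_eq_mul,
          sub_add_cancel]
        refine Finset.sum_congr rfl fun i hi => ?_
        have hi' : X i ω ∈ B := h i (Finset.Icc_subset_Icc_right hk hi)
        simp [hτ, hi']
      rw [h1] at hck
      have h2 : |(k : ℝ) * μ| ≤ c / 2 := by
        rw [abs_mul, abs_of_nonneg (k.cast_nonneg (α := ℝ))]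
        exact le_trans (mul_le_mul_of_nonneg_right (by exact_mod_cast hk) (abs_nonneg _)) hmean
      linarith [abs_add_le (∑ i ∈ Finset.Icc 1 k, Y i ω) (k * μ)]
    · push Not at h
      obtain ⟨i, hi, hi'⟩ := h
      exact Or.inl (Set.mem_biUnion hi hi')
  refine (measure_mono hsub).trans ((measure_union_le _ _).trans (add_le_add ?_ ?_))
  · refine (measure_biUnion_finset_le _ _).trans ?_
    refine (Finset.sum_le_card_nsmul _ _ (Q {ω | X 1 ω ∉ B}) fun i hi => ?_).trans (by simp)
    exact ((hid i (Finset.mem_Icc.1 hi).1).measure_mem_eq hB.compl).le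
  · refine hK.trans ?_
    rw [← ofReal_integral_eq_lintegral_ofReal hint2 (ae_of_all _ fun ω => sq_nonneg _),
      ← ENNReal.ofReal_mul (by positivity)]
    apply ENNReal.ofReal_le_ofReal
    have h1 := Finset.sum_le_card_nsmul _ _ _ hvar
    simp only [Nat.card_Icc, add_tsub_cancel_right, nsmul_eq_mul] at h1
    rw [show 4 * n / c ^ 2 * ∫ ω, τ (X 1 ω) ^ 2 ∂Q =
      (n * ∫ ω, τ (X 1 ω) ^ 2 ∂Q) / (c / 2) ^ 2 by field_simp; ring]
    gcongr

end Kolmogorov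

/-! ### Dyadic blocks and a uniform Marcinkiewicz-Zygmund law -/

lemma tsum_ofReal_le {f : ℕ → ℝ} {b : ℝ} (hf : ∀ i, 0 ≤ f i)
    (h : ∀ n, ∑ i ∈ Finset.range n, f i ≤ b) : ∑' i, ENNReal.ofReal (f i) ≤ ENNReal.ofReal b :=
  ENNReal.tsum_le_of_sum_range_le fun n => by
    rw [← ENNReal.ofReal_sum_of_nonneg fun i _ => hf i]
    exact ENNReal.ofReal_le_ofReal (h n)

/-- The powers of two below x sum to less than twice the largest of them. Integrated, this bounds
the tail probabilities weighted by block lengths. -/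
lemma sum_two_pow_of_lt_le {x : ℝ} (hx : 0 ≤ x) (J n : ℕ) :
    ∑ i ∈ Finset.range n, (if (2 : ℝ) ^ (J + i + 1) < x then (2 : ℝ) ^ (J + i + 1) else 0) ≤
      2 * (if (2 : ℝ) ^ J ≤ x then x else 0) := by
  split_ifs with hJ
  · have h1 : ∀ n, ∑ i ∈ Finset.range n,
        (if (2 : ℝ) ^ (J + i + 1) < x then (2 : ℝ) ^ (J + i + 1) else 0) ≤ 2 ^ (J + n + 1) := by
      intro n
      induction n with
      | zero => simp
      | succ n ih =>
        rw [Finset.sum_range_succ, ← add_assoc, pow_succ 2 (J + n + 1)]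
        split_ifs <;> linarith [pow_pos (two_pos (α := ℝ)) (J + n + 1)]
    induction n with
    | zero => simpa using hx
    | succ n ih =>
      rw [Finset.sum_range_succ]
      split_ifs with h
      · linarith [h1 n]
      · linarith
  · refine (Finset.sum_eq_zero fun i _ => if_neg fun h => hJ ?_).le.trans (by simp)
    exact ((pow_le_pow_right₀ one_le_two (by omega)).trans_lt h).le

/-- Leading indices violating `c` are discarded by induction; from the first admissible one, where
the power is at most `D`, the full geometric tail is summed. -/
lemma sum_geometric_ite_le {q D : ℝ} (hq0 : 0 < q) (hq1 : q < 1) (hD : 0 ≤ D) {c : ℕ → Prop}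
    [DecidablePred c] (hc : ∀ j, c j → q ^ j ≤ D) (J n : ℕ) :
    ∑ i ∈ Finset.range n, (if c (J + i) then q ^ (J + i) else 0) ≤ D / (1 - q) := by
  have hq : 0 < 1 - q := sub_pos.2 hq1
  have hgeom : ∀ J n, ∑ i ∈ Finset.range n, q ^ (J + i) ≤ q ^ J / (1 - q) := by
    intro J n
    simp_rw [pow_add, ← Finset.mul_sum]
    rw [div_eq_mul_inv]
    refine mul_le_mul_of_nonneg_left ?_ (by positivity)
    rw [← tsum_geometric_of_lt_one hq0.le hq1]
    exact (summable_geometric_of_lt_one hq0.le hq1).sum_le_tsum _ fun i _ => by positivity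
  induction n generalizing J with
  | zero => simpa using div_nonneg hD hq.le
  | succ n ih =>
    by_cases h : c J
    · calc ∑ i ∈ Finset.range (n + 1), (if c (J + i) then q ^ (J + i) else 0)
          ≤ ∑ i ∈ Finset.range (n + 1), q ^ (J + i) :=
            Finset.sum_le_sum fun i _ => by split_ifs <;> [rfl; positivity]
        _ ≤ q ^ J / (1 - q) := hgeom _ _
        _ ≤ D / (1 - q) := by gcongr; exact hc J h
    · rw [Finset.sum_range_succ', add_zero, if_neg h, add_zero]
      refine le_of_eq_of_le (Finset.sum_congr rfl fun i _ => ?_) (ih (J + 1))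
      rw [add_right_comm, add_assoc J i 1]

/-- The ratio of the geometric series bounding the variances over dyadic blocks. -/
noncomputable def blockRatio (p : ℝ) : ℝ := (2 : ℝ) ^ (1 - 2 / p)

lemma blockRatio_pos (p : ℝ) : 0 < blockRatio p := Real.rpow_pos_of_pos two_pos _

lemma blockRatio_lt_one {p : ℝ} (hp : 0 < p) (hp2 : p < 2) : blockRatio p < 1 :=
  Real.rpow_lt_one_of_one_lt_of_neg one_lt_two (by rw [sub_neg, lt_div_iff₀ hp]; linarith)

lemma blockRatio_pow (p : ℝ) (j : ℕ) : blockRatio p ^ j = ((2 : ℝ) ^ j) ^ (1 - 2 / p) := by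
  rw [blockRatio, ← Real.rpow_natCast, ← Real.rpow_natCast, ← Real.rpow_mul zero_le_two,
    ← Real.rpow_mul zero_le_two, mul_comm]

/-- Put u = |x|^p, so x² = u^(2/p). A block contributes only if u ≤ 2^(j+1), where the ratio to the
power j + 1 is at most u^(1-2/p); the series is then of order u. For u < K one bounds x² by K^(2/p)
instead and keeps the decay in J. Thus large values cost only a tail moment, and the rest vanishes
as J grows. -/
lemma sum_blockRatio_sq_le {p : ℝ} (hp : 0 < p) (hp2 : p < 2) (x : ℝ) {K : ℝ} (hK : 0 < K)
    (J n : ℕ) :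
    ∑ i ∈ Finset.range n,
        blockRatio p ^ (J + i) * (if |x| ^ p ≤ (2 : ℝ) ^ (J + i + 1) then x ^ 2 else 0) ≤
      K ^ (2 / p) * blockRatio p ^ J / (1 - blockRatio p) +
        (blockRatio p * (1 - blockRatio p))⁻¹ * (if K ≤ |x| ^ p then |x| ^ p else 0) := by
  set q := blockRatio p with hqdef
  have hq0 : 0 < q := blockRatio_pos p
  have hq1 : q < 1 := blockRatio_lt_one hp hp2
  have hq : 0 < 1 - q := sub_pos.2 hq1
  set u := |x| ^ p with hu
  have hu0 : 0 ≤ u := Real.rpow_nonneg (abs_nonneg x) p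
  have hxu : x ^ 2 = u ^ (2 / p) := by
    rw [hu, ← Real.rpow_mul (abs_nonneg x), mul_div_cancel₀ _ hp.ne', Real.rpow_two, sq_abs]
  have hrw : ∀ i, q ^ (J + i) * (if u ≤ (2 : ℝ) ^ (J + i + 1) then x ^ 2 else 0) =
      x ^ 2 * (if u ≤ (2 : ℝ) ^ (J + i + 1) then q ^ (J + i) else 0) := fun i => by
    split_ifs <;> ring
  simp_rw [hrw, ← Finset.mul_sum]
  by_cases hKu : K ≤ u
  · rw [if_pos hKu]
    have hupos : 0 < u := hK.trans_le hKu
    have hx2 : 0 < x ^ 2 := hxu ▸ Real.rpow_pos_of_pos hupos _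
    have h1 := sum_geometric_ite_le (D := u * q⁻¹ / x ^ 2) hq0 hq1 (by positivity)
      (c := fun j => u ≤ (2 : ℝ) ^ (j + 1)) (fun j hj => by
        rw [le_div_iff₀ hx2]
        have h2 : x ^ 2 = u * u ^ (2 / p - 1) := by
          rw [hxu, Real.rpow_sub hupos, Real.rpow_one]; field_simp
        have h3 : u ^ (2 / p - 1) ≤ ((2 : ℝ) ^ (j + 1)) ^ (2 / p - 1) :=
          Real.rpow_le_rpow hu0 hj (by rw [sub_nonneg, le_div_iff₀ hp]; linarith)
        have h4 : ((2 : ℝ) ^ (j + 1)) ^ (2 / p - 1) = (q ^ (j + 1))⁻¹ := by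
          rw [hqdef, blockRatio_pow, ← Real.rpow_neg (by positivity), neg_sub]
        rw [h4] at h3
        calc q ^ j * x ^ 2 ≤ q ^ j * (u * (q ^ (j + 1))⁻¹) := by
              rw [h2]; gcongr
          _ = u * q⁻¹ := by rw [pow_succ]; field_simp) J n
    have hx0 : x ≠ 0 := by rintro rfl; simp at hx2
    have h5 : x ^ 2 * (u * q⁻¹ / x ^ 2 / (1 - q)) = (q * (1 - q))⁻¹ * u := by field_simp
    calc _ ≤ x ^ 2 * (u * q⁻¹ / x ^ 2 / (1 - q)) := mul_le_mul_of_nonneg_left h1 hx2.le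
      _ = (q * (1 - q))⁻¹ * u := h5
      _ ≤ _ := le_add_of_nonneg_left (by positivity)
  · rw [if_neg hKu, mul_zero, add_zero]
    have h1 := sum_geometric_ite_le (D := q ^ J) hq0 hq1 (by positivity)
      (c := fun j => J ≤ j ∧ u ≤ (2 : ℝ) ^ (j + 1))
      (fun j hj => pow_le_pow_of_le_one hq0.le hq1.le hj.1) J n
    simp only [Nat.le_add_right, true_and] at h1
    have h2 : x ^ 2 ≤ K ^ (2 / p) := by
      rw [hxu]; exact Real.rpow_le_rpow hu0 (not_le.1 hKu).le (by positivity)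
    rw [mul_div_assoc]
    exact mul_le_mul h2 h1 (Finset.sum_nonneg fun i _ => by split_ifs <;> positivity)
      (by positivity)

/-- The part of the `p`-th moment carried by large values. -/
noncomputable def tailMoment (Q : Measure Ω) (p : ℝ) (X : Ω → ℝ) (K : ℕ) : ℝ≥0∞ :=
  ∫⁻ ω in {ω | (K : ℝ≥0∞) ≤ ENNReal.ofReal (|X ω| ^ p)}, ENNReal.ofReal (|X ω| ^ p) ∂Q

lemma tailMoment_eq {Q : Measure Ω} {p : ℝ} {X : Ω → ℝ} (hX : Measurable X) (K : ℕ) :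
    tailMoment Q p X K =
      ∫⁻ ω, ENNReal.ofReal (if (K : ℝ) ≤ |X ω| ^ p then |X ω| ^ p else 0) ∂Q := by
  have hm : Measurable fun ω => ENNReal.ofReal (|X ω| ^ p) := by fun_prop
  have hs : MeasurableSet {ω | (K : ℝ≥0∞) ≤ ENNReal.ofReal (|X ω| ^ p)} :=
    measurableSet_le measurable_const hm
  rw [tailMoment, ← lintegral_indicator hs]
  refine lintegral_congr fun ω => ?_
  have h0 : 0 ≤ |X ω| ^ p := Real.rpow_nonneg (abs_nonneg _) p
  by_cases h : (K : ℝ) ≤ |X ω| ^ p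
  · rw [if_pos h, Set.indicator_of_mem]
    change (K : ℝ≥0∞) ≤ _
    rwa [← ENNReal.ofReal_natCast, ENNReal.ofReal_le_ofReal_iff h0]
  · rw [if_neg h, Set.indicator_of_notMem, ENNReal.ofReal_zero]
    change ¬ (K : ℝ≥0∞) ≤ _
    rwa [← ENNReal.ofReal_natCast, ENNReal.ofReal_le_ofReal_iff h0]

lemma tailMoment_anti {Q : Measure Ω} {p : ℝ} {X : Ω → ℝ} {K K' : ℕ} (h : K ≤ K') :
    tailMoment Q p X K' ≤ tailMoment Q p X K :=
  lintegral_mono_set fun ω hω => by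
    change (K : ℝ≥0∞) ≤ _
    exact le_trans (Nat.cast_le.2 h) (Set.mem_ofPred.1 hω)

section MarcinkiewiczZygmund

variable {F : Filtration ℕ mΩ} {Q : Measure Ω} [IsProbabilityMeasure Q] {X : ℕ → Ω → ℝ} {p : ℝ}

/-- Since the mean is zero, the truncated mean is minus the mean of the discarded part. With N =
2^(j+1), there |x|^p > N, and 1/p - 1 ≤ 0 gives N|x| ≤ N^(1/p)|x|^p. Finally N^(1/p) ≤ 2 (2^j)^(1/p)
turns ε/4 into ε/2. -/
lemma mul_abs_integral_truncation_le {Q : Measure Ω} {X : ℕ → Ω → ℝ} {p : ℝ}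
    (hX : Measurable (X 1)) (hint : Integrable (X 1) Q)
    (h0 : ∫ ω, X 1 ω ∂Q = 0) (hp : 1 ≤ p) {ε : ℝ} (hε : 0 < ε) {j : ℕ}
    (htail : tailMoment Q p (X 1) (2 ^ j) ≤ ENNReal.ofReal (ε / 4)) :
    ((2 ^ (j + 1) : ℕ) : ℝ) *
        |∫ ω, {x : ℝ | |x| ^ p ≤ (2 : ℝ) ^ (j + 1)}.indicator id (X 1 ω) ∂Q| ≤
      ε * ((2 : ℝ) ^ j) ^ (1 / p) / 2 := by
  have hp0 : 0 < p := by linarith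
  set B : Set ℝ := {x : ℝ | |x| ^ p ≤ (2 : ℝ) ^ (j + 1)} with hBdef
  have hB : MeasurableSet B := measurableSet_le (by fun_prop) measurable_const
  set N : ℝ := (2 : ℝ) ^ (j + 1) with hN
  have hNpos : 0 < N := by positivity
  have hI : ∀ s : Set ℝ, MeasurableSet s → Integrable (fun ω => s.indicator id (X 1 ω)) Q := by
    intro s hs
    have : (fun ω => s.indicator id (X 1 ω)) = (X 1 ⁻¹' s).indicator (X 1) := by
      ext ω; by_cases h : X 1 ω ∈ s <;> simp [h]
    rw [this]
    exact hint.indicator (hX hs)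
  have h1 : ∫ ω, B.indicator id (X 1 ω) ∂Q = -∫ ω, Bᶜ.indicator id (X 1 ω) ∂Q := by
    rw [eq_neg_iff_add_eq_zero, ← integral_add (hI _ hB) (hI _ hB.compl), ← h0]
    refine integral_congr_ae (ae_of_all _ fun ω => ?_)
    by_cases h : X 1 ω ∈ B <;> simp [h]
  have h2 : ∀ ω, N * |Bᶜ.indicator id (X 1 ω)| ≤
      N ^ (1 / p) * (if ((2 ^ j : ℕ) : ℝ) ≤ |X 1 ω| ^ p then |X 1 ω| ^ p else 0) := by
    intro ω
    by_cases h : X 1 ω ∈ B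
    · simp only [Set.mem_compl_iff, h, not_true_eq_false, not_false_eq_true,
        Set.indicator_of_notMem, abs_zero, mul_zero]
      exact mul_nonneg (by positivity) (by split_ifs <;> positivity)
    · have hlt : N < |X 1 ω| ^ p := not_le.1 h
      have hle : ((2 ^ j : ℕ) : ℝ) ≤ |X 1 ω| ^ p := by
        refine le_trans ?_ hlt.le
        push_cast
        exact pow_le_pow_right₀ one_le_two (Nat.le_succ j)
      rw [if_pos hle, Set.indicator_of_mem (show X 1 ω ∈ Bᶜ from h), id]
      set u := |X 1 ω| ^ p with hu
      have hupos : 0 < u := hNpos.trans hlt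
      have hxu : |X 1 ω| = u ^ (1 / p) := by
        rw [hu, ← Real.rpow_mul (abs_nonneg _), mul_one_div_cancel hp0.ne', Real.rpow_one]
      rw [hxu]
      have h3 : u ^ (1 / p - 1) ≤ N ^ (1 / p - 1) :=
        Real.rpow_le_rpow_of_nonpos hNpos hlt.le
          (by rw [sub_nonpos, div_le_one hp0]; exact hp)
      have h4 : u ^ (1 / p) = u * u ^ (1 / p - 1) := by
        rw [Real.rpow_sub hupos, Real.rpow_one]; field_simp
      have h5 : N ^ (1 / p) = N * N ^ (1 / p - 1) := by
        rw [Real.rpow_sub hNpos, Real.rpow_one]; field_simp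
      rw [h4, h5]
      calc N * (u * u ^ (1 / p - 1)) ≤ N * (u * N ^ (1 / p - 1)) := by gcongr
        _ = N * N ^ (1 / p - 1) * u := by ring
  have h3 : ENNReal.ofReal (N * |∫ ω, Bᶜ.indicator id (X 1 ω) ∂Q|) ≤
      ENNReal.ofReal (N ^ (1 / p) * (ε / 4)) := by
    calc ENNReal.ofReal (N * |∫ ω, Bᶜ.indicator id (X 1 ω) ∂Q|)
        = ENNReal.ofReal N * ‖∫ ω, Bᶜ.indicator id (X 1 ω) ∂Q‖ₑ := by
          rw [ENNReal.ofReal_mul hNpos.le, Real.enorm_eq_ofReal_abs]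
      _ ≤ ENNReal.ofReal N * ∫⁻ ω, ‖Bᶜ.indicator id (X 1 ω)‖ₑ ∂Q := by
          gcongr; exact enorm_integral_le_lintegral_enorm _
      _ = ∫⁻ ω, ENNReal.ofReal (N * |Bᶜ.indicator id (X 1 ω)|) ∂Q := by
          rw [← lintegral_const_mul' _ _ ENNReal.ofReal_ne_top]
          simp_rw [ENNReal.ofReal_mul hNpos.le, Real.enorm_eq_ofReal_abs]
      _ ≤ ∫⁻ ω, ENNReal.ofReal (N ^ (1 / p) *
            (if ((2 ^ j : ℕ) : ℝ) ≤ |X 1 ω| ^ p then |X 1 ω| ^ p else 0)) ∂Q :=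
          lintegral_mono fun ω => ENNReal.ofReal_le_ofReal (h2 ω)
      _ = ENNReal.ofReal (N ^ (1 / p)) * tailMoment Q p (X 1) (2 ^ j) := by
          rw [tailMoment_eq hX, ← lintegral_const_mul' _ _ ENNReal.ofReal_ne_top]
          simp_rw [ENNReal.ofReal_mul (Real.rpow_nonneg hNpos.le (1 / p))]
      _ ≤ ENNReal.ofReal (N ^ (1 / p)) * ENNReal.ofReal (ε / 4) := by gcongr
      _ = _ := (ENNReal.ofReal_mul (Real.rpow_nonneg hNpos.le _)).symm
  rw [ENNReal.ofReal_le_ofReal_iff (by positivity)] at h3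
  rw [h1, abs_neg]
  push_cast
  refine h3.trans ?_
  have h4 : N ^ (1 / p) ≤ 2 * ((2 : ℝ) ^ j) ^ (1 / p) := by
    rw [hN, pow_succ', Real.mul_rpow zero_le_two (by positivity)]
    gcongr
    calc (2 : ℝ) ^ (1 / p) ≤ 2 ^ (1 : ℝ) :=
          Real.rpow_le_rpow_of_exponent_le one_le_two (by rw [div_le_one hp0]; exact hp)
      _ = 2 := Real.rpow_one 2
  nlinarith

variable (hX : ∀ n, 1 ≤ n → Measurable[F n] (X n))
  (hid : ∀ n, 1 ≤ n → IdentDistrib (X n) (X 1) Q Q)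
  (hind : ∀ n, Indep (MeasurableSpace.comap (X (n + 1)) inferInstance) (F n) Q)
  (hint : Integrable (X 1) Q) (h0 : ∫ ω, X 1 ω ∂Q = 0) (hp : 1 ≤ p) (hp2 : p < 2)
include hX hid hind hint h0 hp

/-- Truncation at |x|^p ≤ 2^(j+1), the length of the longest sum. The variance coefficient
4·2^(j+1)/(ε²(2^j)^(2/p)) equals 8/ε² times the j-th power of the block ratio. -/
lemma measure_exists_le_abs_sum_dyadic_block {ε : ℝ} (hε : 0 < ε) {j : ℕ}
    (htail : tailMoment Q p (X 1) (2 ^ j) ≤ ENNReal.ofReal (ε / 4)) :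
    Q {ω | ∃ k, k ≤ 2 ^ (j + 1) ∧
        ε * ((2 : ℝ) ^ j) ^ (1 / p) ≤ |∑ i ∈ Finset.Icc 1 k, X i ω|} ≤
      ∫⁻ ω, ENNReal.ofReal (if (2 : ℝ) ^ (j + 1) < |X 1 ω| ^ p then (2 : ℝ) ^ (j + 1) else 0) ∂Q +
      ∫⁻ ω, ENNReal.ofReal (8 / ε ^ 2 * (blockRatio p ^ j *
        (if |X 1 ω| ^ p ≤ (2 : ℝ) ^ (j + 1) then X 1 ω ^ 2 else 0))) ∂Q := by
  have hp0 : 0 < p := by linarith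
  have hX1 : Measurable (X 1) := (hX 1 le_rfl).mono (F.le 1) le_rfl
  let B : Set ℝ := {x : ℝ | |x| ^ p ≤ (2 : ℝ) ^ (j + 1)}
  have hB : MeasurableSet B := measurableSet_le (by fun_prop) measurable_const
  have hBc : MeasurableSet {ω | X 1 ω ∉ B} := hX1 hB.compl
  have hcpos : 0 < ε * ((2 : ℝ) ^ j) ^ (1 / p) := by positivity
  refine (measure_exists_le_abs_sum_of_truncation hX hid hind hB
    (A := ((2 : ℝ) ^ (j + 1)) ^ (1 / p)) (by positivity) (fun x hx => ?_) (2 ^ (j + 1)) hcpos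
    (mul_abs_integral_truncation_le hX1 hint h0 hp hε htail)).trans (add_le_add ?_ ?_)
  · calc |x| = (|x| ^ p) ^ (1 / p) := by
          rw [← Real.rpow_mul (abs_nonneg _), mul_one_div_cancel hp0.ne', Real.rpow_one]
      _ ≤ _ := Real.rpow_le_rpow (by positivity) hx (by positivity)
  · have : ∀ ω, ENNReal.ofReal
        (if (2 : ℝ) ^ (j + 1) < |X 1 ω| ^ p then (2 : ℝ) ^ (j + 1) else 0) =
        {ω | X 1 ω ∉ B}.indicator
          (fun _ => ((2 ^ (j + 1) : ℕ) : ℝ≥0∞)) ω := fun ω => by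
      by_cases h : (2 : ℝ) ^ (j + 1) < |X 1 ω| ^ p
      · rw [if_pos h, Set.indicator_of_mem (show ω ∈ {ω | X 1 ω ∉ B} from not_le.2 h),
          ← ENNReal.ofReal_natCast]
        push_cast; rfl
      · rw [if_neg h, Set.indicator_of_notMem (fun h' => h (not_le.1 h')), ENNReal.ofReal_zero]
    simp_rw [this]
    rw [lintegral_indicator_const hBc]
  · rw [← lintegral_const_mul' _ _ ENNReal.ofReal_ne_top]
    refine (lintegral_congr fun ω => ?_).le
    rw [← ENNReal.ofReal_mul (by positivity)]
    congr 1
    have h1 : B.indicator id (X 1 ω) ^ 2 =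
        if |X 1 ω| ^ p ≤ (2 : ℝ) ^ (j + 1) then X 1 ω ^ 2 else 0 := by
      by_cases h : |X 1 ω| ^ p ≤ (2 : ℝ) ^ (j + 1)
      · rw [if_pos h, Set.indicator_of_mem (show X 1 ω ∈ B from h), id]
      · rw [if_neg h, Set.indicator_of_notMem (show X 1 ω ∉ B from h)]; simp
    change _ * B.indicator id (X 1 ω) ^ 2 = _
    rw [h1, ← mul_assoc]
    congr 1
    have h2 : (((2 : ℝ) ^ j) ^ (1 / p)) ^ 2 = ((2 : ℝ) ^ j) ^ (2 / p) := by
      rw [← Real.rpow_two, ← Real.rpow_mul (by positivity)]; congr 1; ring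
    rw [blockRatio_pow, Real.rpow_sub (by positivity), Real.rpow_one, mul_pow, h2]
    push_cast
    field_simp
    ring

include hp2

/-- Each k lies in the dyadic block indexed by its binary logarithm; the block bounds are summed
inside the integral by Tonelli. The free parameter `K` separates large from moderate values. -/
theorem measure_exists_rpow_le_abs_sum {ε : ℝ} (hε : 0 < ε) {J K : ℕ} (hK : 1 ≤ K)
    (htail : tailMoment Q p (X 1) (2 ^ J) ≤ ENNReal.ofReal (ε / 4)) :
    Q {ω | ∃ k : ℕ, 2 ^ J ≤ k ∧ ε * (k : ℝ) ^ (1 / p) ≤ |∑ i ∈ Finset.Icc 1 k, X i ω|} ≤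
      2 * tailMoment Q p (X 1) (2 ^ J) +
      (ENNReal.ofReal (8 / ε ^ 2 * ((K : ℝ) ^ (2 / p) * blockRatio p ^ J / (1 - blockRatio p))) +
      ENNReal.ofReal (8 / ε ^ 2 * (blockRatio p * (1 - blockRatio p))⁻¹) *
        tailMoment Q p (X 1) K) := by
  have hp0 : 0 < p := by linarith
  have hq0 := blockRatio_pos p
  have hq : 0 < 1 - blockRatio p := sub_pos.2 (blockRatio_lt_one hp0 hp2)
  have hX1 : Measurable (X 1) := (hX 1 le_rfl).mono (F.le 1) le_rfl
  have hsub : {ω | ∃ k : ℕ, 2 ^ J ≤ k ∧ ε * (k : ℝ) ^ (1 / p) ≤ |∑ i ∈ Finset.Icc 1 k, X i ω|} ⊆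
      ⋃ n : ℕ, {ω | ∃ k : ℕ, k ≤ 2 ^ (J + n + 1) ∧
        ε * ((2 : ℝ) ^ (J + n)) ^ (1 / p) ≤ |∑ i ∈ Finset.Icc 1 k, X i ω|} := by
    rintro ω ⟨k, hk, h⟩
    have hk0 : k ≠ 0 := by have := Nat.two_pow_pos J; omega
    obtain ⟨n, hn⟩ := Nat.exists_eq_add_of_le ((Nat.le_log_iff_pow_le one_lt_two hk0).2 hk)
    refine Set.mem_iUnion.2 ⟨n, k, ?_, le_trans ?_ h⟩
    · rw [← hn]; exact (Nat.lt_pow_succ_log_self one_lt_two k).le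
    · gcongr
      rw [← hn]
      exact_mod_cast Nat.pow_log_le_self 2 hk0
  have hm1 : ∀ j : ℕ, Measurable fun ω => ENNReal.ofReal
      (if (2 : ℝ) ^ (j + 1) < |X 1 ω| ^ p then (2 : ℝ) ^ (j + 1) else 0) := fun j =>
    (Measurable.ite (measurableSet_lt measurable_const (by fun_prop))
      measurable_const measurable_const).ennreal_ofReal
  have hm2 : ∀ j : ℕ, Measurable fun ω => ENNReal.ofReal (8 / ε ^ 2 * (blockRatio p ^ j *
        (if |X 1 ω| ^ p ≤ (2 : ℝ) ^ (j + 1) then X 1 ω ^ 2 else 0))) := fun j =>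
    (((Measurable.ite (measurableSet_le (by fun_prop) measurable_const)
      (by fun_prop) measurable_const).const_mul _).const_mul _).ennreal_ofReal
  refine (measure_mono hsub).trans ((measure_iUnion_le _).trans ?_)
  refine (ENNReal.tsum_le_tsum fun n => measure_exists_le_abs_sum_dyadic_block hX hid hind hint h0
    hp hε ((tailMoment_anti (Nat.pow_le_pow_right two_pos (Nat.le_add_right J n))).trans
      htail)).trans ?_
  rw [ENNReal.tsum_add, ← lintegral_tsum fun n => (hm1 _).aemeasurable,
    ← lintegral_tsum fun n => (hm2 _).aemeasurable]
  refine add_le_add ?_ ?_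
  · rw [tailMoment_eq hX1, ← lintegral_const_mul' _ _ (by simp)]
    refine lintegral_mono fun ω => ?_
    refine (tsum_ofReal_le (fun n => by split_ifs <;> positivity)
      (sum_two_pow_of_lt_le (by positivity) J)).trans ?_
    rw [ENNReal.ofReal_mul zero_le_two]
    simp
  · calc ∫⁻ ω, ∑' n, ENNReal.ofReal (8 / ε ^ 2 * (blockRatio p ^ (J + n) *
          (if |X 1 ω| ^ p ≤ (2 : ℝ) ^ (J + n + 1) then X 1 ω ^ 2 else 0))) ∂Q
        ≤ ∫⁻ ω, (ENNReal.ofReal (8 / ε ^ 2 *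
              ((K : ℝ) ^ (2 / p) * blockRatio p ^ J / (1 - blockRatio p))) +
            ENNReal.ofReal (8 / ε ^ 2 * (blockRatio p * (1 - blockRatio p))⁻¹) *
            ENNReal.ofReal (if (K : ℝ) ≤ |X 1 ω| ^ p then |X 1 ω| ^ p else 0)) ∂Q := by
          refine lintegral_mono fun ω => ?_
          rw [← ENNReal.ofReal_mul (by positivity), ← ENNReal.ofReal_add (by positivity)
            (mul_nonneg (by positivity) (by split_ifs <;> positivity))]
          refine tsum_ofReal_le (fun n => mul_nonneg (by positivity)
            (mul_nonneg (by positivity) (by split_ifs <;> positivity))) fun n => ?_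
          rw [← Finset.mul_sum, mul_assoc, ← mul_add]
          exact mul_le_mul_of_nonneg_left
            (sum_blockRatio_sq_le hp0 hp2 (X 1 ω) (by exact_mod_cast hK) J n) (by positivity)
      _ = _ := by
          rw [lintegral_add_left measurable_const, lintegral_const, measure_univ, mul_one,
            lintegral_const_mul' _ _ ENNReal.ofReal_ne_top, tailMoment_eq hX1]

end MarcinkiewiczZygmund

/-- A strong law of large numbers of Marcinkiewicz-Zygmund type, uniform over a class of
distributions with uniformly integrable `p`-th moment. -/
theorem exists_forall_measure_exists_rpow_le_abs_sum {F : Filtration ℕ mΩ} {𝒬 : Set (Measure Ω)}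
    {X : Measure Ω → ℕ → Ω → ℝ} {p : ℝ} (hp : 1 ≤ p) (hp2 : p < 2)
    (hprob : ∀ Q ∈ 𝒬, IsProbabilityMeasure Q)
    (hX : ∀ Q ∈ 𝒬, ∀ n, 1 ≤ n → Measurable[F n] (X Q n))
    (hid : ∀ Q ∈ 𝒬, ∀ n, 1 ≤ n → IdentDistrib (X Q n) (X Q 1) Q Q)
    (hind : ∀ Q ∈ 𝒬, ∀ n, Indep (MeasurableSpace.comap (X Q (n + 1)) inferInstance) (F n) Q)
    (hint : ∀ Q ∈ 𝒬, Integrable (X Q 1) Q) (h0 : ∀ Q ∈ 𝒬, ∫ ω, X Q 1 ω ∂Q = 0)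
    (hUI : Tendsto (fun K : ℕ => ⨆ Q ∈ 𝒬, tailMoment Q p (X Q 1) K) atTop (𝓝 0))
    {ε : ℝ} (hε : 0 < ε) {η : ℝ≥0∞} (hη : 0 < η) :
    ∃ m₀ : ℕ, ∀ m, m₀ ≤ m → ∀ Q ∈ 𝒬,
      Q {ω | ∃ k, m ≤ k ∧ ε * (k : ℝ) ^ (1 / p) ≤ |∑ i ∈ Finset.Icc 1 k, X Q i ω|} ≤ η := by
  have hp0 : 0 < p := by linarith
  have hη3 : 0 < η / 3 := ENNReal.div_pos hη.ne' (by simp)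
  -- The order matters: `K` is fixed first to make the tail moment small, then `J` is taken large
  -- enough to absorb the factor K^(2/p).
  obtain ⟨K, hK1, hK⟩ : ∃ K : ℕ, 1 ≤ K ∧
      ENNReal.ofReal (8 / ε ^ 2 * (blockRatio p * (1 - blockRatio p))⁻¹) *
        (⨆ Q ∈ 𝒬, tailMoment Q p (X Q 1) K) ≤ η / 3 := by
    have h1 := ENNReal.Tendsto.const_mul (a := ENNReal.ofReal
      (8 / ε ^ 2 * (blockRatio p * (1 - blockRatio p))⁻¹)) hUI (Or.inr ENNReal.ofReal_ne_top)
    rw [mul_zero] at h1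
    exact ((eventually_ge_atTop 1).and (h1.eventually (ge_mem_nhds hη3))).exists
  have hpow : Tendsto (fun J : ℕ => 2 ^ J) atTop atTop := tendsto_pow_atTop_atTop_of_one_lt one_lt_two
  obtain ⟨J, hJ1, hJ2, hJ3⟩ : ∃ J : ℕ,
      2 * (⨆ Q ∈ 𝒬, tailMoment Q p (X Q 1) (2 ^ J)) ≤ η / 3 ∧
      (⨆ Q ∈ 𝒬, tailMoment Q p (X Q 1) (2 ^ J)) ≤ ENNReal.ofReal (ε / 4) ∧
      ENNReal.ofReal (8 / ε ^ 2 *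
        ((K : ℝ) ^ (2 / p) * blockRatio p ^ J / (1 - blockRatio p))) ≤ η / 3 := by
    have h1 := ENNReal.Tendsto.const_mul (a := 2) (hUI.comp hpow) (Or.inr (by simp))
    rw [mul_zero] at h1
    have h2 : Tendsto (fun J : ℕ => ENNReal.ofReal (8 / ε ^ 2 *
        ((K : ℝ) ^ (2 / p) * blockRatio p ^ J / (1 - blockRatio p)))) atTop (𝓝 0) := by
      have h3 := (((tendsto_pow_atTop_nhds_zero_of_lt_one (blockRatio_pos p).le
        (blockRatio_lt_one hp0 hp2)).const_mul ((K : ℝ) ^ (2 / p))).div_const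
          (1 - blockRatio p)).const_mul (8 / ε ^ 2)
      simpa using ENNReal.tendsto_ofReal h3
    exact ((h1.eventually (ge_mem_nhds hη3)).and (((hUI.comp hpow).eventually
      (ge_mem_nhds (by simpa using hε))).and (h2.eventually (ge_mem_nhds hη3)))).exists
  refine ⟨2 ^ J, fun m hm Q hQ => ?_⟩
  have := hprob Q hQ
  have hle : ∀ K, tailMoment Q p (X Q 1) K ≤ ⨆ Q ∈ 𝒬, tailMoment Q p (X Q 1) K := fun K =>
    le_iSup₂ (f := fun Q (_ : Q ∈ 𝒬) => tailMoment Q p (X Q 1) K) Q hQ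
  refine (measure_mono ?_).trans ((measure_exists_rpow_le_abs_sum (hX Q hQ) (hid Q hQ) (hind Q hQ)
    (hint Q hQ) (h0 Q hQ) hp hp2 hε hK1 ((hle _).trans hJ2)).trans ?_)
  · rintro ω ⟨k, hk, h⟩
    exact ⟨k, hm.trans hk, h⟩
  · calc _ ≤ η / 3 + (η / 3 + η / 3) := by
          refine add_le_add (le_trans ?_ hJ1) (add_le_add hJ3 (le_trans ?_ hK))
          · gcongr; exact hle _
          · gcongr; exact hle _
      _ = η := by rw [← add_assoc, ENNReal.add_thirds]

/-! ### The rate of convergence: claim (iii) -/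

section Rate

variable {F : Filtration ℕ mΩ} {E₁ E₂ : ℕ → Ω → ℝ} {𝒬 : Set (Measure Ω)}

/-- The centered log-increment of the constant portfolio `l`. -/
noncomputable def centeredLogReturn (E₁ E₂ : ℕ → Ω → ℝ) (l : ℝ) (Q : Measure Ω) (n : ℕ) (ω : Ω) :
    ℝ :=
  Real.log (mix l (E₁ n ω) (E₂ n ω)) - ∫ ω, Real.log (mix l (E₁ 1 ω) (E₂ 1 ω)) ∂Q

lemma tailMoment_centeredLogReturn {Q : Measure Ω} {lstar : Measure Ω → ℝ}
    (hl : IsLogOptimalPortfolio E₁ E₂ Q (lstar Q)) (hE₁ : Measurable (E₁ 1))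
    (hE₂ : Measurable (E₂ 1)) (hbot : ⊥ < ellStar E₁ E₂ Q) (htop : ellStar E₁ E₂ Q < ⊤)
    {p : ℝ} (hp : 0 ≤ p) (K : ℕ) :
    tailMoment Q p (centeredLogReturn E₁ E₂ (lstar Q) Q 1) K =
      ∫⁻ ω in {ω | (K : ℝ≥0∞) ≤ centeredPow E₁ E₂ lstar p Q ω},
        centeredPow E₁ E₂ lstar p Q ω ∂Q := by
  obtain ⟨hpos, -, hell⟩ := hl.pos_and_integrable hE₁ hE₂ hbot htop
  have h : ∀ᵐ ω ∂Q, ENNReal.ofReal (|centeredLogReturn E₁ E₂ (lstar Q) Q 1 ω| ^ p) =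
      centeredPow E₁ E₂ lstar p Q ω := by
    filter_upwards [hpos] with ω hω
    rw [centeredPow, logIncr, elog_of_pos hω, hell, ← EReal.coe_sub, EReal.abs_def,
      ENNReal.ofReal_rpow_of_nonneg (abs_nonneg _) hp]
    rfl
  rw [tailMoment]
  refine (setLIntegral_congr ?_).trans (lintegral_congr_ae (ae_restrict_of_ae h))
  filter_upwards [h] with ω hω
  exact congrArg (fun y => (K : ℝ≥0∞) ≤ y) hω

/-- log W_k minus k times the optimal rate splits into log W_k - log V_k, controlled as in claim
(ii) with a_k = k^(1/p), and a sum of centered i.i.d. log-returns, controlled by the uniform law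
above. Each part receives ε/2. -/
theorem unifEventuallySmall_growth_rate
    (hE : ∀ n, 1 ≤ n → Measurable[F n] (E₁ n) ∧ Measurable[F n] (E₂ n))
    (h𝒬 : ∀ Q ∈ 𝒬, IsProbabilityMeasure Q ∧ IsIIDNonneg F E₁ E₂ Q ∧
      ⊥ < ellStar E₁ E₂ Q ∧ ellStar E₁ E₂ Q < ⊤)
    {W : ℕ → Ω → ℝ} (hW : W ∈ eProcessClass F E₁ E₂ 𝒬) {r : ℕ → ℝ}
    (hreg : ∀ Q ∈ 𝒬, ∀ n, 1 ≤ n → ∀ᵐ ω ∂Q,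
      regret (fun i => E₁ i ω) (fun i => E₂ i ω) (W n ω) n ≤ (r n : EReal))
    {lstar : Measure Ω → ℝ} (hl : ∀ Q ∈ 𝒬, IsLogOptimalPortfolio E₁ E₂ Q (lstar Q))
    {𝒬₀ : Set (Measure Ω)} (h𝒬₀ : 𝒬₀ ⊆ 𝒬) {p : ℝ} (hp : 1 ≤ p) (hp2 : p < 2)
    (hUI : HasUnifIntegrableMoment E₁ E₂ lstar p 𝒬₀)
    (hr : r =o[atTop] (fun n : ℕ => (n : ℝ) ^ (1 / p))) :
    UnifEventuallySmall 𝒬₀ (fun Q k ω =>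
      (((k : ℝ) ^ (1 - 1 / p) : ℝ) : EReal) *
        (((((k : ℝ)⁻¹ : ℝ) : EReal) * elog (W k ω) - ellStar E₁ E₂ Q).abs : EReal)) := by
  have hp0 : 0 < p := by linarith
  have hE1 : Measurable (E₁ 1) := (hE 1 le_rfl).1.mono (F.le 1) le_rfl
  have hE2 : Measurable (E₂ 1) := (hE 1 le_rfl).2.mono (F.le 1) le_rfl
  have hfin : ∀ Q ∈ 𝒬, _ := fun Q hQ =>
    (hl Q hQ).pos_and_integrable hE1 hE2 (h𝒬 Q hQ).2.2.1 (h𝒬 Q hQ).2.2.2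
  have hUI' : Tendsto (fun K : ℕ => ⨆ Q ∈ 𝒬₀,
      tailMoment Q p (centeredLogReturn E₁ E₂ (lstar Q) Q 1) K) atTop (𝓝 0) := by
    refine Tendsto.congr (fun K => ?_) hUI
    refine iSup_congr fun Q => iSup_congr fun hQ => ?_
    obtain ⟨-, -, hbot, htop⟩ := h𝒬 Q (h𝒬₀ hQ)
    exact (tailMoment_centeredLogReturn (hl Q (h𝒬₀ hQ)) hE1 hE2 hbot htop hp0.le K).symm
  have hm : ∀ Q : Measure Ω, Measurable fun x : ℝ × ℝ => Real.log (mix (lstar Q) x.1 x.2) -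
      ∫ ω, Real.log (mix (lstar Q) (E₁ 1 ω) (E₂ 1 ω)) ∂Q := fun Q =>
    (Real.measurable_log.comp (by unfold mix; fun_prop)).sub_const _
  refine unifEventuallySmall_of_forall_exists fun ε hε η hη => ?_
  have hη2 : 0 < η / 2 := ENNReal.half_pos hη.ne'
  obtain ⟨m₁, hm₁⟩ := exists_forall_measure_exists_rpow_le_abs_sum (F := F) (𝒬 := 𝒬₀)
    (X := fun Q => centeredLogReturn E₁ E₂ (lstar Q) Q) hp hp2
    (fun Q hQ => (h𝒬 Q (h𝒬₀ hQ)).1)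
    (fun Q hQ n hn => (hm Q).comp ((hE n hn).1.prodMk (hE n hn).2))
    (fun Q hQ n hn => ((h𝒬 Q (h𝒬₀ hQ)).2.1.identDistrib n hn).comp (hm Q))
    (fun Q hQ n => indep_of_indep_of_le_left ((h𝒬 Q (h𝒬₀ hQ)).2.1.indep n)
      (((hm Q).comp
        (comap_measurable fun ω => (E₁ (n + 1) ω, E₂ (n + 1) ω))).comap_le))
    (fun Q hQ => by
      have := (h𝒬 Q (h𝒬₀ hQ)).1
      exact (hfin Q (h𝒬₀ hQ)).2.1.sub (integrable_const _))
    (fun Q hQ => by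
      have := (h𝒬 Q (h𝒬₀ hQ)).1
      simp only [centeredLogReturn]
      rw [integral_sub (hfin Q (h𝒬₀ hQ)).2.1 (integrable_const _)]
      simp)
    hUI' (half_pos hε) hη2
  -- Here p < 2 enters again: 1/p ≥ 1/2 makes these exponentials summable.
  have ha : ∀ ε : ℝ, 0 < ε → Summable fun k : ℕ => Real.exp (-((k : ℝ) ^ (1 / p) * ε / 2)) :=
    fun ε hε => (summable_exp_neg_rpow_mul (s := 1 / p)
      (one_div_le_one_div_of_le hp0 hp2.le) (half_pos hε)).congr fun k => by
        congr 2; ring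
  have har : Tendsto (fun n : ℕ => ((n : ℝ) ^ (1 / p))⁻¹ * r n) atTop (𝓝 0) := by
    simpa only [inv_mul_eq_div] using hr.tendsto_div_nhds_zero
  obtain ⟨m₂, hm₂⟩ := exists_measure_not_abs_log_sub_lt hE h𝒬 hreg hW ha har (half_pos hε) hη2
  refine ⟨max m₁ (max m₂ 1), fun Q hQ => ?_⟩
  obtain ⟨hprob, hiid, hbot, htop⟩ := h𝒬 Q (h𝒬₀ hQ)
  refine le_trans ((measure_mono_ae ?_).trans (measure_union_le _ _)) ((add_le_add
    (hm₁ (max m₁ (max m₂ 1)) (le_max_left _ _) Q hQ)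
    (hm₂ (max m₁ (max m₂ 1)) ((le_max_left _ _).trans (le_max_right _ _)) Q (h𝒬₀ hQ) _
      (hl Q (h𝒬₀ hQ)))).trans (ENNReal.add_halves η).le)
  filter_upwards [ae_forall_mix_pos hE hiid hbot htop (hl Q (h𝒬₀ hQ))] with ω hpos
  rintro ⟨k, hk, h⟩
  have hk1 : 1 ≤ k := (le_max_right m₂ 1).trans ((le_max_right m₁ _).trans hk)
  have hk0 : (0 : ℝ) < k := by exact_mod_cast hk1
  by_contra hnot
  have hA : |∑ i ∈ Finset.Icc 1 k, centeredLogReturn E₁ E₂ (lstar Q) Q i ω| <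
      ε / 2 * (k : ℝ) ^ (1 / p) := by
    by_contra! h'
    exact hnot (Or.inl ⟨k, hk, h'⟩)
  obtain ⟨h1, -, h3, h4⟩ : 0 < W k ω ∧ 0 < wealth E₁ E₂ (fun _ _ => lstar Q) k ω ∧
      0 < (k : ℝ) ^ (1 / p) ∧ |Real.log (W k ω) -
        Real.log (wealth E₁ E₂ (fun _ _ => lstar Q) k ω)| < ε / 2 * (k : ℝ) ^ (1 / p) := by
    by_contra h'
    exact hnot (Or.inr ⟨k, hk, h'⟩)
  rw [log_wealth_const hpos] at h4
  set ℓ := ∫ ω, Real.log (mix (lstar Q) (E₁ 1 ω) (E₂ 1 ω)) ∂Q with hℓ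
  simp only [centeredLogReturn] at hA
  rw [Finset.sum_sub_distrib] at hA
  simp only [Finset.sum_const, Nat.card_Icc, add_tsub_cancel_right, nsmul_eq_mul, ← hℓ] at hA
  simp only [elog_of_pos h1, (hfin Q (h𝒬₀ hQ)).2.2, ← hℓ] at h
  rw [← EReal.coe_mul, ← EReal.coe_sub, EReal.coe_abs, ← EReal.coe_mul,
    EReal.coe_le_coe_iff] at h
  have h5 : (k : ℝ) ^ (1 - 1 / p) * |(k : ℝ)⁻¹ * Real.log (W k ω) - ℓ| =
      |Real.log (W k ω) - k * ℓ| / (k : ℝ) ^ (1 / p) := by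
    rw [show Real.log (W k ω) - k * ℓ = k * ((k : ℝ)⁻¹ * Real.log (W k ω) - ℓ) by field_simp,
      abs_mul, abs_of_pos hk0, Real.rpow_sub hk0, Real.rpow_one]
    ring
  rw [h5, le_div_iff₀ h3] at h
  have h6 := abs_add_le (Real.log (W k ω) -
      ∑ i ∈ Finset.Icc 1 k, Real.log (mix (lstar Q) (E₁ i ω) (E₂ i ω)))
    (∑ i ∈ Finset.Icc 1 k, Real.log (mix (lstar Q) (E₁ i ω) (E₂ i ω)) - k * ℓ)
  rw [sub_add_sub_cancel] at h6
  linarith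

end Rate

end PortfolioLogOpt

theorem theorem3 {Ω : Type*} [mΩ : MeasurableSpace Ω] (F : Filtration ℕ mΩ)
    (E₁ E₂ : ℕ → Ω → ℝ)
    (hE : ∀ n, 1 ≤ n → Measurable[F n] (E₁ n) ∧ Measurable[F n] (E₂ n))
    (𝒬 : Set (Measure Ω))
    (h𝒬 : ∀ Q ∈ 𝒬, IsProbabilityMeasure Q ∧ IsIIDNonneg F E₁ E₂ Q ∧
      ⊥ < ellStar E₁ E₂ Q ∧ ellStar E₁ E₂ Q < ⊤)
    (W : ℕ → Ω → ℝ) (hW : W ∈ eProcessClass F E₁ E₂ 𝒬)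
    (r : ℕ → ℝ) (hr : r =o[atTop] (fun n : ℕ => (n : ℝ)))
    (hreg : ∀ Q ∈ 𝒬, ∀ n, 1 ≤ n → ∀ᵐ ω ∂Q,
      regret (fun i => E₁ i ω) (fun i => E₂ i ω) (W n ω) n ≤ (r n : EReal)) :
    -- the log-optimal portfolios exist
    (∀ Q ∈ 𝒬, ∃ l, IsLogOptimalPortfolio E₁ E₂ Q l) ∧
    -- (i)
    IsUnifLogOptimal 𝒬 (eProcessClass F E₁ E₂ 𝒬) W ∧
    -- (ii) and (iii), for any choice of log-optimal portfolios
    ∀ lstar : Measure Ω → ℝ, (∀ Q ∈ 𝒬, IsLogOptimalPortfolio E₁ E₂ Q (lstar Q)) →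
      (∀ a : ℕ → ℝ,
        (∀ ε : ℝ, 0 < ε → Summable (fun k : ℕ => Real.exp (-(a k * ε / 2)))) →
        Tendsto (fun n => (a n)⁻¹ * r n) atTop (𝓝 0) →
        IsUnifAsympEquiv 𝒬 W (fun Q => wealth E₁ E₂ (fun _ _ => lstar Q)) a) ∧
      (∀ 𝒬₀ ⊆ 𝒬, ∀ p : ℝ, 1 ≤ p → p < 2 →
        HasUnifIntegrableMoment E₁ E₂ lstar p 𝒬₀ →
        r =o[atTop] (fun n : ℕ => (n : ℝ) ^ (1 / p)) →
        UnifEventuallySmall 𝒬₀ (fun Q k ω =>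
          (((k : ℝ) ^ (1 - 1 / p) : ℝ) : EReal) *
            (((((k : ℝ)⁻¹ : ℝ) : EReal) * elog (W k ω) - ellStar E₁ E₂ Q).abs : EReal))) := by
  refine ⟨fun Q hQ => ?_, isUnifLogOptimal_of_regret_le hE h𝒬 hreg hr, fun lstar hl =>
    ⟨fun a ha har => isUnifAsympEquiv_of_regret_le hE h𝒬 hreg hW ha har hl,
      fun 𝒬₀ h𝒬₀ p hp hp2 hUI hrp =>
        unifEventuallySmall_growth_rate hE h𝒬 hW hreg hl h𝒬₀ hp hp2 hUI hrp⟩⟩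
  obtain ⟨hprob, hiid, hbot, htop⟩ := h𝒬 Q hQ
  exact exists_isLogOptimalPortfolio ((hE 1 le_rfl).1.mono (F.le 1) le_rfl)
    ((hE 1 le_rfl).2.mono (F.le 1) le_rfl) (hiid.nonneg 1 le_rfl) hbot htop
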